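/- Circuits. An algebraic circuit over a field $K$ in variables $x_1,\dots,x_n$ is a finite directed acyclic graph with a designated output node, whose leaves are labelled by variables or elements of $K$, whose internal gates (of arbitrary fan-in) are labelled by $+$ or $\times$, and whose wires carry constants from $K$; parallel wires are allowed. A value travelling along a wire is multiplied by the constant on that wire. The size of a circuit is its number of wires. For a field $F$, a formal variable $\varepsilon$ and $f \in F[x_1,\dots,x_n]$, the border circuit complexity $\overline{\mathrm{size}}(f)$ is the least size of a circuit over $F(\varepsilon)$ that computes $f + \varepsilon h$ for some $h \in F[\varepsilon][x_1,\dots,x_n]$. Theorem (Bürgisser). There is a polynomial $q$ with coefficients in $\mathbb{N}$ such that the following holds for every field $F$ of characteristic zero and all integers $n, s \ge 0$. Let $P \in F[x_1,\dots,x_n]$ be a nonzero polynomial computed by a circuit over $F$ of size $s$ (no bound on $\deg P$ is assumed), and let $g \in F[x_1,\dots,x_n]$ be a factor of $P$. Then $$\overline{\mathrm{size}}(g) \le q(s + \deg g).$$ -/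

import Mathlib

/-- The label of the `i`-th node of an algebraic circuit over the field `K` in the variables
`x_0, …, x_{n-1}`. A leaf carries a variable or a constant. An internal `+` or `×` gate, of
arbitrary fan-in, carries the list of its incoming wires; a wire is a constant from `K` together
with the earlier node it comes from (two wires may come from the same node). -/
inductive Gate (K : Type*) (n i : ℕ) where
  | var (j : Fin n) : Gate K n i
  | const (c : K) : Gate K n i
  | add (wires : List (K × Fin i)) : Gate K n i
  | mul (wires : List (K × Fin i)) : Gate K n i

/-- The number of wires entering a node. -/
def Gate.fanIn {K : Type*} {n i : ℕ} : Gate K n i → ℕ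
  | .var _ => 0
  | .const _ => 0
  | .add wires => wires.length
  | .mul wires => wires.length

/-- An algebraic circuit over `K` in `n` variables: a finite directed acyclic graph, whose nodes
are listed in a topological order, with a distinguished output node. -/
structure Circuit (K : Type*) (n : ℕ) where
  /-- the number of nodes -/
  nodes : ℕ
  /-- the label of each node; its wires come from earlier nodes -/
  gate : (i : Fin nodes) → Gate K n i
  /-- the output node -/
  output : Fin nodes

namespace Circuit

/-- The size of a circuit is its number of wires. -/
def size {K : Type*} {n : ℕ} (C : Circuit K n) : ℕ :=
  ∑ i, (C.gate i).fanIn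

/-- The polynomial computed at the node `i`. -/
noncomputable def value {K : Type*} [Field K] {n : ℕ} (C : Circuit K n) (i : Fin C.nodes) :
    MvPolynomial (Fin n) K :=
  match C.gate i with
  | .var j => MvPolynomial.X j
  | .const c => MvPolynomial.C c
  | .add wires =>
      (wires.map fun w => MvPolynomial.C w.1 * C.value ⟨w.2, w.2.isLt.trans i.isLt⟩).sum
  | .mul wires =>
      (wires.map fun w => MvPolynomial.C w.1 * C.value ⟨w.2, w.2.isLt.trans i.isLt⟩).prod
termination_by i.val
decreasing_by all_goals exact w.2.isLt

/-- The circuit `C` computes the polynomial `f`. -/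
def Computes {K : Type*} [Field K] {n : ℕ} (C : Circuit K n) (f : MvPolynomial (Fin n) K) : Prop :=
  C.value C.output = f

/-- The circuit `C`, with constants from `F(ε)`, is a border computation of `f ∈ F[x]`: it computes
`f + ε * h` for some `h ∈ F[ε][x]`. -/
def BorderComputes {F : Type*} [Field F] {n : ℕ} (C : Circuit (RatFunc F) n)
    (f : MvPolynomial (Fin n) F) : Prop :=
  ∃ h : MvPolynomial (Fin n) (Polynomial F),
    C.Computes
      (MvPolynomial.map (RatFunc.C : F →+* RatFunc F) f +
        MvPolynomial.C (RatFunc.X : RatFunc F) *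
          MvPolynomial.map (algebraMap (Polynomial F) (RatFunc F)) h)

end Circuit

/-- The border circuit complexity of `f`: the least size of a circuit over `F(ε)` that border
computes `f`. -/
noncomputable def borderSize {F : Type*} [Field F] {n : ℕ} (f : MvPolynomial (Fin n) F) : ℕ∞ :=
  ⨅ (C : Circuit (RatFunc F) n) (_ : C.BorderComputes f), (C.size : ℕ∞)

/-! Unique factorisation reduces everything to a prime factor `g` of degree `d`: a factor has at
most as many primes as its degree. Write `P = g ^ e * h` with `g ∤ h`. Neither `e` nor `deg h` is
bounded, so `P` is used only through its logarithmic derivative, in which `e` is a mere scalar: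
`P'/P = e * g'/g + h'/h`. To isolate `g'/g`, the expansion point is moved close to the zeros of `g`,
where the first summand dominates.

In detail, scale `g` and choose a direction `b` and a point `a` with `g(a) ≠ 0` such that `G(Y) =
g(a + bY)` is monic of degree `d` and coprime to `h(a + bY)` (`exists_isCoprime_line`). Adjoin to
`F(ε)` an element `Y` with `G(Y) ^ d = ε`, and expand `P(a + bY + T(x - a))` in powers of `T`. The
constant term of `h` has an inverse without pole at `ε = 0`, because `h(a + bY)` is coprime to `G ^
d`; so `ε * h'/h` vanishes in the limit. The `i`-th coefficient of `g'/g` is `u_i / G ^ (i + 1)`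
with `u_i` of degree at most `(i + 1)(d - 1)` in `Y`. For `i < d`, multiplication by `ε = G ^ d`
turns it into `u_i * G ^ (d - 1 - i)`, of degree below `d * d`. It is therefore already reduced, and
its `Y ^ 0` coordinate is its value at `Y = 0`. Up to the factor `g(a) ^ d` this is the `i`-th
coefficient of the logarithmic derivative of `g(a + T(x - a))` (`exists_logDerivative_limit`).
Integration, which like the division by `e` needs characteristic zero, recovers that polynomial; `T
= 1` gives `g`.

The cost stays polynomial because only the powers of `T` up to `d` are kept and the extension has
rank `d * d`; both rings are simulated by coordinates (`Cost.coords`). -/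

/-! ### Straight-line computations in commutative rings. -/

/-- `Reach B k T` says that `T` is obtained from `B` by adjoining, one after the other, `k` sums or
products of two elements that are already there. -/
inductive Reach {S : Type*} [CommRing S] (B : Set S) : ℕ → Set S → Prop
  | base : Reach B 0 B
  | add {k : ℕ} {T : Set S} {a b : S} (h : Reach B k T) (ha : a ∈ T) (hb : b ∈ T) :
      Reach B (k + 1) (insert (a + b) T)
  | mul {k : ℕ} {T : Set S} {a b : S} (h : Reach B k T) (ha : a ∈ T) (hb : b ∈ T) :
      Reach B (k + 1) (insert (a * b) T)

/-- All elements of `V` are obtained together from those of `B` by at most `k` additions and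
multiplications. -/
def Cost {S : Type*} [CommRing S] (B : Set S) (k : ℕ) (V : Set S) : Prop :=
  ∃ l T, l ≤ k ∧ Reach B l T ∧ V ⊆ T

section Cost

variable {S S' : Type*} [CommRing S] [CommRing S'] {B B' V V' : Set S} {k l : ℕ}

theorem Reach.subset {T : Set S} (h : Reach B k T) : B ⊆ T := by
  induction h with
  | base => exact subset_rfl
  | add _ _ _ ih => exact ih.trans (Set.subset_insert _ _)
  | mul _ _ _ ih => exact ih.trans (Set.subset_insert _ _)

theorem Reach.trans {T T' : Set S} (h : Reach B k T) (h' : Reach T l T') :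
    Reach B (k + l) T' := by
  induction h' with
  | base => exact h
  | add _ ha hb ih => exact ih.add ha hb
  | mul _ ha hb ih => exact ih.mul ha hb

theorem Reach.mono_base {T : Set S} (h : Reach B k T) (hB : B ⊆ B') :
    ∃ T', T ⊆ T' ∧ Reach B' k T' := by
  induction h with
  | base => exact ⟨B', hB, .base⟩
  | add _ ha hb ih =>
    obtain ⟨T', hT, h⟩ := ih
    exact ⟨_, Set.insert_subset_insert hT, h.add (hT ha) (hT hb)⟩
  | mul _ ha hb ih =>
    obtain ⟨T', hT, h⟩ := ih
    exact ⟨_, Set.insert_subset_insert hT, h.mul (hT ha) (hT hb)⟩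

theorem Cost.of_subset (h : V ⊆ B) : Cost B k V :=
  ⟨0, B, Nat.zero_le _, .base, h⟩

theorem Cost.mono (h : Cost B k V) (hB : B ⊆ B') (hk : k ≤ l) (hV : V' ⊆ V) : Cost B' l V' := by
  obtain ⟨m, T, hm, hT, hVT⟩ := h
  obtain ⟨T', hTT, hT'⟩ := hT.mono_base hB
  exact ⟨m, T', hm.trans hk, hT', (hV.trans hVT).trans hTT⟩

theorem Cost.mono_cost (h : Cost B k V) (hk : k ≤ l) : Cost B l V :=
  h.mono subset_rfl hk subset_rfl

theorem Cost.trans (h : Cost B k V) (h' : Cost (B ∪ V) l V') : Cost B (k + l) (V ∪ V') := by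
  obtain ⟨m, T, hm, hT, hVT⟩ := h
  obtain ⟨m', T', hm', hT', hVT'⟩ := h'
  obtain ⟨T'', hTT, hT''⟩ := hT'.mono_base (Set.union_subset hT.subset hVT)
  exact ⟨m + m', T'', by omega, hT.trans hT'',
    Set.union_subset (hVT.trans hT''.subset) (hVT'.trans hTT)⟩

theorem Cost.trans_right (h : Cost B k V) (h' : Cost (B ∪ V) l V') : Cost B (k + l) V' :=
  (h.trans h').mono subset_rfl le_rfl Set.subset_union_right

theorem Cost.union (h : Cost B k V) (h' : Cost B l V') : Cost B (k + l) (V ∪ V') :=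
  h.trans (h'.mono Set.subset_union_left le_rfl subset_rfl)

theorem Cost.add {a b : S} (ha : a ∈ B) (hb : b ∈ B) : Cost B 1 {a + b} :=
  ⟨1, _, le_rfl, Reach.base.add ha hb, by simp⟩

theorem Cost.mul {a b : S} (ha : a ∈ B) (hb : b ∈ B) : Cost B 1 {a * b} :=
  ⟨1, _, le_rfl, Reach.base.mul ha hb, by simp⟩

theorem Cost.add' {a b : S} (ha : Cost B k {a}) (hb : Cost B l {b}) :
    Cost B (k + l + 1) {a + b} :=
  (ha.union hb).trans_right (Cost.add (by simp) (by simp))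

theorem Cost.mul' {a b : S} (ha : Cost B k {a}) (hb : Cost B l {b}) :
    Cost B (k + l + 1) {a * b} :=
  (ha.union hb).trans_right (Cost.mul (by simp) (by simp))

theorem Cost.sum {ι : Type*} (s : Finset ι) (f : ι → S) (h0 : (0 : S) ∈ B)
    (h : ∀ i ∈ s, Cost B k {f i}) : Cost B (s.card * (k + 1)) {∑ i ∈ s, f i} := by
  classical
  induction s using Finset.induction_on with
  | empty => exact .of_subset (by simpa using h0)
  | insert i s hi ih =>
    rw [Finset.sum_insert hi, Finset.card_insert_of_notMem hi]
    refine ((h i (by simp)).add' (ih fun j hj => h j (by simp [hj]))).mono_cost ?_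
    rw [add_mul]; omega

theorem Cost.iUnion {ι : Type*} [Fintype ι] {V : ι → Set S} (h : ∀ i, Cost B k (V i)) :
    Cost B (Fintype.card ι * k) (⋃ i, V i) := by
  classical
  suffices ∀ s : Finset ι, Cost B (s.card * k) (⋃ i ∈ s, V i) by simpa using this Finset.univ
  intro s
  induction s using Finset.induction_on with
  | empty => exact .of_subset (by simp)
  | insert i s hi ih =>
    rw [Finset.set_biUnion_insert, Finset.card_insert_of_notMem hi]
    exact ((h i).union ih).mono_cost (by rw [add_mul]; omega)

theorem Cost.seq (v : ℕ → S) (N : ℕ) (h : ∀ i < N, Cost (B ∪ v '' {j | j < i}) k {v i}) :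
    Cost B (N * k) (v '' {j | j < N}) := by
  induction N with
  | zero => exact .of_subset (by simp)
  | succ N ih =>
    refine ((ih fun i hi => h i (by omega)).trans (h N (by omega))).mono subset_rfl
      (by rw [add_mul, one_mul]) ?_
    rintro _ ⟨j, hj, rfl⟩
    rcases Nat.lt_succ_iff_lt_or_eq.1 hj with hj | rfl
    · exact Or.inl ⟨j, hj, rfl⟩
    · exact Or.inr rfl

theorem Cost.pow_list {a : S} (ha : a ∈ B) (h1 : (1 : S) ∈ B) (N : ℕ) :
    Cost B N ((fun i => a ^ i) '' {j | j < N}) := by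
  have := Cost.seq (B := B) (k := 1) (fun i => a ^ i) N fun i _ => by
    cases i with
    | zero => exact .of_subset (by simp [h1])
    | succ i =>
      simp only [pow_succ]
      exact Cost.mul (Or.inr ⟨i, by simp, rfl⟩) (Or.inl ha)
  simpa using this

theorem Cost.map (φ : S →+* S') (h : Cost B k V) : Cost (φ '' B) k (φ '' V) := by
  obtain ⟨l, T, hl, hT, hV⟩ := h
  refine ⟨l, φ '' T, hl, ?_, Set.image_mono hV⟩
  clear hl hV
  induction hT with
  | base => exact .base
  | add _ ha hb ih =>
    rw [Set.image_insert_eq, map_add]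
    exact ih.add ⟨_, ha, rfl⟩ ⟨_, hb, rfl⟩
  | mul _ ha hb ih =>
    rw [Set.image_insert_eq, map_mul]
    exact ih.mul ⟨_, ha, rfl⟩ ⟨_, hb, rfl⟩

/-- Replacing the elements of the base by elements that have to be computed themselves. -/
theorem Cost.subst {f : S} (h : Cost B k {f}) (hB : ∀ b ∈ B, Cost B' l {b}) :
    Cost B' (k * (2 * l + 1) + l) {f} := by
  obtain ⟨m, T, hm, hT, hV⟩ := h
  -- `B` may be infinite, so its elements cannot be computed beforehand. Each operand from `B` is
  -- recomputed where it is used, at cost at most `2 * l` per step; a final `l` covers the case `f ∈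
  -- B`.
  have key : ∃ V, Cost B' (m * (2 * l + 1)) V ∧ T ⊆ V ∪ B := by
    clear hV hm
    have aux : ∀ {V : Set S} {a : S}, a ∈ V ∪ B → Cost (B' ∪ V) l {a} := by
      rintro V a (ha | ha)
      · exact .of_subset (by simp [ha])
      · exact (hB a ha).mono Set.subset_union_left le_rfl subset_rfl
    induction hT with
    | base => exact ⟨∅, .of_subset (by simp), by simp⟩
    | @add _ T a b _ ha hb ih =>
      obtain ⟨V, hV, hT⟩ := ih
      refine ⟨_, (hV.trans ((aux (hT ha)).add' (aux (hT hb)))).mono_cost ?_, ?_⟩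
      · rw [add_mul]; omega
      · rintro x (rfl | hx)
        · simp
        · rcases hT hx with h | h <;> simp [h]
    | @mul _ T a b _ ha hb ih =>
      obtain ⟨V, hV, hT⟩ := ih
      refine ⟨_, (hV.trans ((aux (hT ha)).mul' (aux (hT hb)))).mono_cost ?_, ?_⟩
      · rw [add_mul]; omega
      · rintro x (rfl | hx)
        · simp
        · rcases hT hx with h | h <;> simp [h]
  obtain ⟨W, hC, hTV⟩ := key
  have h1 : m * (2 * l + 1) ≤ k * (2 * l + 1) := Nat.mul_le_mul_right _ hm
  rcases hTV (hV rfl) with h | h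
  · exact hC.mono subset_rfl (by omega) (Set.singleton_subset_iff.2 h)
  · exact (hB f h).mono_cost (by omega)

/-- Simulation of a computation in `S'` by the coordinates of its intermediate results. -/
theorem Cost.coords {ι : Type*} [Fintype ι] {B' V' : Set S'} (π : ι → S' → S) (c : ι → ι → ι → S)
    (hadd : ∀ i a b, π i (a + b) = π i a + π i b)
    (hmul : ∀ i a b, π i (a * b) = ∑ j, ∑ j', c i j j' * (π j a * π j' b))
    (hc : ∀ i j j', c i j j' ∈ B) (h0 : (0 : S) ∈ B) (hB : ∀ i, ∀ b ∈ B', π i b ∈ B)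
    (h : Cost B' k V') :
    Cost B (k * (4 * Fintype.card ι ^ 3 + 1)) (⋃ i, π i '' V') := by
  obtain ⟨m, T, hm, hT, hV⟩ := h
  suffices Cost B (m * (4 * Fintype.card ι ^ 3 + 1)) (⋃ i, π i '' T) from
    this.mono subset_rfl (Nat.mul_le_mul_right _ hm)
      (Set.iUnion_mono fun i => Set.image_mono hV)
  clear hV hm
  set N := Fintype.card ι with hN
  have step : ∀ {k : ℕ} {T : Set S'} {v : S'}, Cost B k (⋃ i, π i '' T) →
      (∀ i, Cost (B ∪ ⋃ i, π i '' T) (4 * N ^ 2) {π i v}) →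
      Cost B (k + (4 * N ^ 3 + 1)) (⋃ i, π i '' insert v T) := by
    intro k T v h1 h2
    refine (h1.trans (Cost.iUnion h2)).mono subset_rfl ?_ ?_
    · rw [← hN]; nlinarith
    · simp only [Set.image_insert_eq]
      refine Set.iUnion_subset fun i => Set.insert_subset (Or.inr ?_) ?_
      · exact Set.mem_iUnion.2 ⟨i, rfl⟩
      · exact (Set.subset_iUnion (fun i => π i '' T) i).trans Set.subset_union_left
  have mem : ∀ {T : Set S'} {a : S'} (i : ι), a ∈ T → π i a ∈ B ∪ ⋃ i, π i '' T :=
    fun i ha => Or.inr (Set.mem_iUnion.2 ⟨i, _, ha, rfl⟩)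
  induction hT with
  | base => exact .of_subset (Set.iUnion_subset fun i => by rintro _ ⟨b, hb, rfl⟩; exact hB i b hb)
  | @add _ T a b _ ha hb ih =>
    rw [add_mul, one_mul]
    refine step ih fun i => ?_
    have : 0 < N := Fintype.card_pos_iff.2 ⟨i⟩
    rw [hadd]
    exact (Cost.add (mem i ha) (mem i hb)).mono_cost (by nlinarith)
  | @mul _ T a b _ ha hb ih =>
    rw [add_mul, one_mul]
    refine step ih fun i => ?_
    have : 0 < N := Fintype.card_pos_iff.2 ⟨i⟩
    rw [hmul]
    -- An inner sum costs `N * 3` and the outer one `N * (3 * N + 1) ≤ 4 * N ^ 2`.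
    refine (Cost.sum (k := N * 3) Finset.univ (fun j => ∑ j', c i j j' * (π j a * π j' b))
      (Or.inl h0) fun j _ =>
      (Cost.sum (k := 2) Finset.univ (fun j' => c i j j' * (π j a * π j' b)) (Or.inl h0)
        fun j' _ => ?_).mono_cost ?_).mono_cost ?_
    · have h1 : Cost (B ∪ ⋃ i, π i '' T) 0 {c i j j'} := .of_subset (by simp [hc])
      exact (h1.mul' (Cost.mul (mem j ha) (mem j' hb))).mono_cost (by omega)
    · simp [hN]
    · rw [Finset.card_univ, ← hN]; nlinarith

end Cost

/-! ### Translation between circuits and straight-line computations. -/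

section Circuits

variable {K : Type*} {n : ℕ}

/-- The constants and the variables, which a circuit has for free. -/
def leaves (K : Type*) [CommRing K] (n : ℕ) : Set (MvPolynomial (Fin n) K) :=
  Set.range MvPolynomial.C ∪ Set.range MvPolynomial.X

/-- The polynomial computed by a gate from the polynomials computed at the earlier nodes. -/
noncomputable def Gate.eval [Field K] {i : ℕ} (v : Fin i → MvPolynomial (Fin n) K) :
    Gate K n i → MvPolynomial (Fin n) K
  | .var j => MvPolynomial.X j
  | .const c => MvPolynomial.C c
  | .add wires => (wires.map fun w => MvPolynomial.C w.1 * v w.2).sum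
  | .mul wires => (wires.map fun w => MvPolynomial.C w.1 * v w.2).prod

theorem Circuit.value_eq [Field K] (C : Circuit K n) (i : Fin C.nodes) :
    C.value i = (C.gate i).eval fun j => C.value ⟨j, j.isLt.trans i.isLt⟩ := by
  rw [Circuit.value]
  cases C.gate i <;> rfl

/-- The circuit with a further node. -/
abbrev Circuit.snoc (C : Circuit K n) (γ : Gate K n C.nodes) : Circuit K n where
  nodes := C.nodes + 1
  gate := Fin.lastCases (motive := fun i => Gate K n i) γ C.gate
  output := Fin.last _

theorem Circuit.gate_snoc_castSucc (C : Circuit K n) (γ : Gate K n C.nodes) (i : Fin C.nodes) :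
    (C.snoc γ).gate i.castSucc = C.gate i := by
  simp [Circuit.snoc]

theorem Circuit.gate_snoc_last (C : Circuit K n) (γ : Gate K n C.nodes) :
    (C.snoc γ).gate (Fin.last C.nodes) = γ := by
  simp [Circuit.snoc]

theorem Circuit.size_snoc (C : Circuit K n) (γ : Gate K n C.nodes) :
    (C.snoc γ).size = C.size + γ.fanIn := by
  have h : (C.snoc γ).size = ∑ i : Fin (C.nodes + 1), ((C.snoc γ).gate i).fanIn := rfl
  rw [h, Fin.sum_univ_castSucc, Circuit.gate_snoc_last]
  congr 1
  exact Finset.sum_congr rfl fun i _ => congrArg Gate.fanIn (C.gate_snoc_castSucc γ i)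

theorem Circuit.value_snoc_castSucc [Field K] (C : Circuit K n) (γ : Gate K n C.nodes) (k : ℕ)
    (hk : k < C.nodes) : (C.snoc γ).value (Fin.castSucc ⟨k, hk⟩) = C.value ⟨k, hk⟩ := by
  induction k using Nat.strong_induction_on with
  | _ k ih =>
    rw [Circuit.value_eq, Circuit.value_eq, Circuit.gate_snoc_castSucc]
    congr 1
    funext j
    exact ih j j.isLt (j.isLt.trans hk)

theorem Circuit.value_snoc_last [Field K] (C : Circuit K n) (γ : Gate K n C.nodes) :
    (C.snoc γ).value (Fin.last C.nodes) = γ.eval C.value := by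
  rw [Circuit.value_eq, Circuit.gate_snoc_last]
  congr 1
  funext j
  exact C.value_snoc_castSucc γ j j.isLt

theorem Circuit.range_value_snoc [Field K] (C : Circuit K n) (γ : Gate K n C.nodes) :
    Set.range (C.snoc γ).value = insert (γ.eval C.value) (Set.range C.value) := by
  apply subset_antisymm
  · rintro _ ⟨i, rfl⟩
    refine Fin.lastCases ?_ (fun i => ?_) (show Fin (C.nodes + 1) from i)
    · exact Or.inl (C.value_snoc_last γ)
    · exact Or.inr ⟨i, (C.value_snoc_castSucc γ i i.isLt).symm⟩
  · refine Set.insert_subset ⟨_, C.value_snoc_last γ⟩ ?_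
    rintro _ ⟨i, rfl⟩
    exact ⟨_, C.value_snoc_castSucc γ i i.isLt⟩

theorem exists_circuit_of_subset_leaves [Field K] (V : Finset (MvPolynomial (Fin n) K))
    (hV : ↑V ⊆ leaves K n) : ∃ C : Circuit K n, C.size = 0 ∧ ↑V ⊆ Set.range C.value := by
  classical
  induction V using Finset.induction_on with
  -- A circuit needs an output, hence at least one node; the constant `0` is a dummy.
  | empty => exact ⟨⟨1, fun _ => .const 0, 0⟩, by simp [Circuit.size, Gate.fanIn], by simp⟩
  | insert v V hv ih =>
    rw [Finset.coe_insert, Set.insert_subset_iff] at hV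
    obtain ⟨C, hC, hVC⟩ := ih hV.2
    rcases hV.1 with ⟨c, rfl⟩ | ⟨j, rfl⟩
    · refine ⟨C.snoc (.const c), by simp [Circuit.size_snoc, hC, Gate.fanIn], ?_⟩
      rw [Circuit.range_value_snoc, Finset.coe_insert]
      exact Set.insert_subset_insert hVC
    · refine ⟨C.snoc (.var j), by simp [Circuit.size_snoc, hC, Gate.fanIn], ?_⟩
      rw [Circuit.range_value_snoc, Finset.coe_insert]
      exact Set.insert_subset_insert hVC

/-- `T` contains all constants and may be infinite, whereas a circuit has finitely many nodes. Hence
only a finite part `V` is realised, and the induction varies `V` to request the operands of the last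
step. -/
theorem Reach.exists_circuit [Field K] {k : ℕ} {T : Set (MvPolynomial (Fin n) K)}
    (h : Reach (leaves K n) k T) (V : Finset (MvPolynomial (Fin n) K)) (hV : ↑V ⊆ T) :
    ∃ C : Circuit K n, C.size = 2 * k ∧ ↑V ⊆ Set.range C.value := by
  classical
  induction h generalizing V with
  | base => exact exists_circuit_of_subset_leaves V hV
  | @add k T a b _ ha hb ih =>
    obtain ⟨C, hC, hVC⟩ := ih (insert a (insert b (V.erase (a + b)))) (by
      intro v hv
      simp only [Finset.coe_insert, Finset.coe_erase, Set.mem_insert_iff, Set.mem_sdiff,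
        Set.mem_singleton_iff] at hv
      rcases hv with rfl | rfl | ⟨hv, hne⟩
      exacts [ha, hb, (hV hv).resolve_left hne])
    obtain ⟨i, hi⟩ := hVC (show a ∈ _ by simp)
    obtain ⟨j, hj⟩ := hVC (show b ∈ _ by simp)
    refine ⟨C.snoc (.add [(1, i), (1, j)]), by simp [Circuit.size_snoc, hC, Gate.fanIn]; ring, ?_⟩
    rw [Circuit.range_value_snoc]
    intro v hv
    by_cases hvab : v = a + b
    · left; simp [Gate.eval, hi, hj, hvab]
    · right; exact hVC (by simp [hvab, Finset.mem_coe.1 hv])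
  | @mul k T a b _ ha hb ih =>
    obtain ⟨C, hC, hVC⟩ := ih (insert a (insert b (V.erase (a * b)))) (by
      intro v hv
      simp only [Finset.coe_insert, Finset.coe_erase, Set.mem_insert_iff, Set.mem_sdiff,
        Set.mem_singleton_iff] at hv
      rcases hv with rfl | rfl | ⟨hv, hne⟩
      exacts [ha, hb, (hV hv).resolve_left hne])
    obtain ⟨i, hi⟩ := hVC (show a ∈ _ by simp)
    obtain ⟨j, hj⟩ := hVC (show b ∈ _ by simp)
    refine ⟨C.snoc (.mul [(1, i), (1, j)]), by simp [Circuit.size_snoc, hC, Gate.fanIn]; ring, ?_⟩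
    rw [Circuit.range_value_snoc]
    intro v hv
    by_cases hvab : v = a * b
    · left; simp [Gate.eval, hi, hj, hvab]
    · right; exact hVC (by simp [hvab, Finset.mem_coe.1 hv])

/-- A straight-line computation gives a circuit. -/
theorem Cost.exists_circuit [Field K] {k : ℕ} {f : MvPolynomial (Fin n) K}
    (h : Cost (leaves K n) k {f}) : ∃ C : Circuit K n, C.size ≤ 2 * k ∧ C.Computes f := by
  obtain ⟨l, T, hl, hT, hf⟩ := h
  obtain ⟨C, hC, hfC⟩ := hT.exists_circuit {f} (by simpa using hf)
  obtain ⟨i, hi⟩ := hfC (show f ∈ _ by simp)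
  exact ⟨⟨C.nodes, C.gate, i⟩, by change C.size ≤ _; omega, by
    rw [Circuit.Computes, ← hi]
    -- The values at the nodes do not depend on the choice of the output.
    have : ∀ (k : ℕ) (hk : k < C.nodes),
        (⟨C.nodes, C.gate, i⟩ : Circuit K n).value ⟨k, hk⟩ = C.value ⟨k, hk⟩ := by
      intro k
      induction k using Nat.strong_induction_on with
      | _ k ih =>
        intro hk
        rw [Circuit.value_eq, Circuit.value_eq]
        congr 1
        funext j
        exact ih j j.isLt (j.isLt.trans hk)
    exact this i i.isLt⟩

theorem Cost.gate_eval [Field K] {i : ℕ} (v : Fin i → MvPolynomial (Fin n) K) (γ : Gate K n i)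
    {B : Set (MvPolynomial (Fin n) K)} (hB : leaves K n ⊆ B) (hv : Set.range v ⊆ B) :
    Cost B (2 * γ.fanIn) {γ.eval v} := by
  have hC : ∀ c, MvPolynomial.C c ∈ B := fun c => hB (Or.inl ⟨c, rfl⟩)
  have hw : ∀ w : K × Fin i, Cost B 1 {MvPolynomial.C w.1 * v w.2} := fun w =>
    Cost.mul (hC _) (hv ⟨_, rfl⟩)
  cases γ with
  | var j => exact .of_subset (Set.singleton_subset_iff.2 (hB (Or.inr ⟨j, rfl⟩)))
  | const c => exact .of_subset (Set.singleton_subset_iff.2 (hC c))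
  | add l =>
    simp only [Gate.fanIn, Gate.eval]
    induction l with
    | nil => exact .of_subset (Set.singleton_subset_iff.2 (by simpa using hC 0))
    | cons w l ih =>
      simp only [List.map_cons, List.sum_cons, List.length_cons]
      exact ((hw w).add' ih).mono_cost (by omega)
  | mul l =>
    simp only [Gate.fanIn, Gate.eval]
    induction l with
    | nil => exact .of_subset (Set.singleton_subset_iff.2 (by simpa using hC 1))
    | cons w l ih =>
      simp only [List.map_cons, List.prod_cons, List.length_cons]
      exact ((hw w).mul' ih).mono_cost (by omega)

/-- A circuit gives a straight-line computation. -/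
theorem Circuit.cost [Field K] (C : Circuit K n) (i : Fin C.nodes) :
    Cost (leaves K n) (2 * C.size) {C.value i} := by
  suffices ∀ k (hk : k ≤ C.nodes), Cost (leaves K n)
      (2 * ∑ j : Fin k, (C.gate (Fin.castLE hk j)).fanIn)
      (Set.range fun j : Fin k => C.value (Fin.castLE hk j)) from
    (this C.nodes le_rfl).mono subset_rfl le_rfl (Set.singleton_subset_iff.2 ⟨i, rfl⟩)
  intro k
  induction k with
  | zero => exact fun _ => .of_subset (by simp)
  | succ k ih =>
    intro hk
    rw [Fin.sum_univ_castSucc, mul_add]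
    refine ((ih (by omega)).trans (V' := {C.value ⟨k, hk⟩}) ?_).mono subset_rfl le_rfl ?_
    · rw [Circuit.value_eq]
      refine Cost.gate_eval _ _ Set.subset_union_left ?_
      rintro _ ⟨j, rfl⟩
      exact Or.inr ⟨j, rfl⟩
    · rintro _ ⟨j, rfl⟩
      refine Fin.lastCases ?_ (fun j => ?_) j
      · exact Or.inr rfl
      · exact Or.inl ⟨j, rfl⟩

end Circuits

/-! ### Restriction to lines, and coprimality on a general line. -/

section Line

open Polynomial

variable {F : Type*} [Field F] {n : ℕ} {S : Type*} [CommRing S] [Algebra F S]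

/-- Substitution of the line through `a` with direction `b`. -/
noncomputable def line (a : Fin n → S) (b : Fin n → F) : MvPolynomial (Fin n) F →ₐ[F] S[X] :=
  MvPolynomial.aeval fun j => C (a j) + C (algebraMap F S (b j)) * X

theorem line_monomial (a : Fin n → S) (b : Fin n → F) (m : Fin n →₀ ℕ) (c : F) :
    (line a b (MvPolynomial.monomial m c)).natDegree ≤ m.degree ∧
    (line a b (MvPolynomial.monomial m c)).coeff m.degree =
      algebraMap F S (MvPolynomial.eval b (MvPolynomial.monomial m c)) := by
  have h1 : ∀ j, (C (a j) + C (algebraMap F S (b j)) * X).natDegree ≤ 1 := fun j => by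
    compute_degree
  have key : ∀ s : Finset (Fin n),
      (∏ j ∈ s, (C (a j) + C (algebraMap F S (b j)) * X) ^ m j).natDegree ≤ ∑ j ∈ s, m j ∧
      (∏ j ∈ s, (C (a j) + C (algebraMap F S (b j)) * X) ^ m j).coeff (∑ j ∈ s, m j) =
        ∏ j ∈ s, algebraMap F S (b j) ^ m j := by
    intro s
    induction s using Finset.induction_on with
    | empty => simp
    | insert j s hj ih =>
      rw [Finset.prod_insert hj, Finset.prod_insert hj, Finset.sum_insert hj]
      have h2 := natDegree_pow_le_of_le (m j) (h1 j)
      rw [mul_one] at h2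
      refine ⟨natDegree_mul_le_of_le h2 ih.1, ?_⟩
      rw [coeff_mul_add_eq_of_natDegree_le h2 ih.1, ih.2]
      congr 1
      have := coeff_pow_of_natDegree_le (m := m j) (h1 j)
      rw [mul_one] at this
      simp [this]
  have h := key Finset.univ
  rw [line, MvPolynomial.aeval_monomial, Finsupp.prod_fintype _ _ (fun _ => pow_zero _),
    MvPolynomial.eval_monomial, Finsupp.prod_fintype _ _ (fun _ => pow_zero _),
    Finsupp.degree_eq_sum, Polynomial.algebraMap_apply]
  refine ⟨(natDegree_C_mul_le _ _).trans h.1, ?_⟩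
  simp [h.2]

/-- The top coefficient in `Y` depends on the direction only. Normalising it to `1` makes the
restriction monic for every base point, the generic one included. -/
theorem line_natDegree_coeff (a : Fin n → S) (b : Fin n → F) (f : MvPolynomial (Fin n) F) {D : ℕ}
    (hf : f.totalDegree ≤ D) : (line a b f).natDegree ≤ D ∧ (line a b f).coeff D =
      algebraMap F S (MvPolynomial.eval b (MvPolynomial.homogeneousComponent D f)) := by
  have hdeg : ∀ m ∈ f.support, m.degree ≤ D := fun m hm =>
    (MvPolynomial.le_totalDegree hm).trans' (le_of_eq rfl) |>.trans hf
  constructor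
  · rw [f.as_sum, map_sum]
    exact natDegree_sum_le_of_forall_le _ _ fun m hm =>
      (line_monomial a b m _).1.trans (hdeg m hm)
  · conv_lhs => rw [f.as_sum, map_sum]
    rw [MvPolynomial.homogeneousComponent_apply, map_sum, map_sum, finsetSum_coeff,
      Finset.sum_filter]
    refine Finset.sum_congr rfl fun m hm => ?_
    have := line_monomial a b m (f.coeff m)
    split_ifs with h
    · rw [← h, this.2]
    · exact coeff_eq_zero_of_natDegree_lt (this.1.trans_lt (lt_of_le_of_ne (hdeg m hm) h))

theorem map_line {S' : Type*} [CommRing S'] [Algebra F S'] (φ : S →ₐ[F] S') (a : Fin n → S)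
    (b : Fin n → F) (f : MvPolynomial (Fin n) F) :
    (line a b f).map (φ : S →+* S') = line (fun j => φ (a j)) b f := by
  have : (mapAlgHom φ).comp (line a b) = line (fun j => φ (a j)) b := by
    ext j
    simp [line]
  exact DFunLike.congr_fun this f

theorem eval_zero_line (a : Fin n → S) (b : Fin n → F) (f : MvPolynomial (Fin n) F) :
    (line a b f).eval 0 = MvPolynomial.aeval a f := by
  induction f using MvPolynomial.induction_on with
  | C c => simp [line]
  | add p q hp hq => simp [hp, hq]
  | mul_X p j hp => simp [hp]; simp [line]

/-- The map `x ↦ x + bY` is an automorphism of `F[x][Y]` with inverse `x ↦ x - bY`, so it preserves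
primality of the constant polynomial `g`. Setting `Y = 0` descends divisibility back to `F[x]`. -/
theorem prime_line_X (b : Fin n → F) {g : MvPolynomial (Fin n) F} (hg : Prime g) :
    Prime (line (S := MvPolynomial (Fin n) F) MvPolynomial.X b g) ∧
    ∀ h, ¬ g ∣ h → ¬ line (S := MvPolynomial (Fin n) F) MvPolynomial.X b g ∣
      line (S := MvPolynomial (Fin n) F) MvPolynomial.X b h := by
  let φ : (Fin n → F) → (MvPolynomial (Fin n) F)[X] →+* (MvPolynomial (Fin n) F)[X] := fun b =>
    eval₂RingHom (line (S := MvPolynomial (Fin n) F) MvPolynomial.X b).toRingHom X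
  have hφ : ∀ b b', (∀ j, b j + b' j = 0) → (φ b).comp (φ b') = RingHom.id _ := by
    intro b b' hb
    apply Polynomial.ringHom_ext'
    · apply MvPolynomial.ringHom_ext
      · intro c
        simp [φ, ← MvPolynomial.algebraMap_eq]
      · intro j
        have := congrArg (fun x => C (MvPolynomial.C x) : F → (MvPolynomial (Fin n) F)[X]) (hb j)
        simp only [map_add, map_zero] at this
        simp [φ, line]
        linear_combination X * this
    · simp [φ]
  let e : (MvPolynomial (Fin n) F)[X] ≃+* (MvPolynomial (Fin n) F)[X] :=
    RingEquiv.ofRingHom (φ b) (φ (-b)) (hφ _ _ (by simp)) (hφ _ _ (by simp))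
  have he : ∀ f, line (S := MvPolynomial (Fin n) F) MvPolynomial.X b f = e (C f) := fun f => by
    simp [e, φ]
  refine ⟨?_, fun h hh hd => hh ?_⟩
  · rw [he, MulEquiv.prime_iff]
    exact Polynomial.prime_C_iff.2 hg
  · rw [he, he, map_dvd_iff] at hd
    simpa using map_dvd (evalRingHom (0 : MvPolynomial (Fin n) F)) hd

theorem MvPolynomial.exists_eval_ne_zero [Infinite F] {f : MvPolynomial (Fin n) F} (hf : f ≠ 0) :
    ∃ a, MvPolynomial.eval a f ≠ 0 := by
  by_contra! h
  exact hf (MvPolynomial.funext fun x => by simp [h x])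

/-- A prime polynomial stays coprime to a polynomial that it does not divide on a general line with
given direction. -/
theorem exists_isCoprime_line [Infinite F] (b : Fin n → F) {g h : MvPolynomial (Fin n) F}
    (hg : Prime g)
    (hb : MvPolynomial.eval b (MvPolynomial.homogeneousComponent g.totalDegree g) = 1)
    (hgh : ¬ g ∣ h) :
    ∃ a : Fin n → F, MvPolynomial.eval a g ≠ 0 ∧ IsCoprime (line a b g) (line a b h) := by
  obtain ⟨hG, hGH⟩ := prime_line_X b hg
  replace hGH := hGH h hgh
  have hdeg := line_natDegree_coeff (S := MvPolynomial (Fin n) F) MvPolynomial.X b g le_rfl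
  rw [hb, map_one] at hdeg
  set G := line (S := MvPolynomial (Fin n) F) MvPolynomial.X b g with hGdef
  set H := line (S := MvPolynomial (Fin n) F) MvPolynomial.X b h with hHdef
  have hmonic : G.Monic := monic_of_natDegree_le_of_coeff_eq_one _ hdeg.1 hdeg.2
  have := AdjoinRoot.isDomain_of_prime hG
  have := hmonic.finite_adjoinRoot
  have hne : AdjoinRoot.mk G H ≠ 0 := by rwa [Ne, AdjoinRoot.mk_eq_zero]
  -- The quotient by `G` is a domain integral over `F[x]`, so the nonzero class of `H` divides a
  -- nonzero `r ∈ F[x]`. This `r` plays the role of a resultant: the lines to avoid are those with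
  -- `r(a) = 0`.
  obtain ⟨r, hr, v, hv⟩ := ((Algebra.IsIntegral.isIntegral (R := MvPolynomial (Fin n) F)
    (AdjoinRoot.mk G H)).isAlgebraic).exists_nonzero_dvd (mem_nonZeroDivisors_of_ne_zero hne)
  obtain ⟨v, rfl⟩ := AdjoinRoot.mk_surjective v
  rw [AdjoinRoot.algebraMap_eq, ← AdjoinRoot.mk_C, ← map_mul, AdjoinRoot.mk_eq_mk] at hv
  obtain ⟨u, hu⟩ := hv
  obtain ⟨a, ha⟩ := MvPolynomial.exists_eval_ne_zero (mul_ne_zero hr hg.ne_zero)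
  rw [map_mul] at ha
  refine ⟨a, right_ne_zero_of_mul ha, ?_⟩
  have hmap : ∀ f, (line (S := MvPolynomial (Fin n) F) MvPolynomial.X b f).map
      (MvPolynomial.eval a) = line a b f := fun f => by
    have := map_line (MvPolynomial.aeval a) (MvPolynomial.X : Fin n → MvPolynomial (Fin n) F) b f
    simpa [MvPolynomial.aeval_def, MvPolynomial.eval] using this
  have hu' := congrArg (Polynomial.map (MvPolynomial.eval a)) hu
  simp only [Polynomial.map_sub, Polynomial.map_mul, map_C, hGdef, hHdef, hmap] at hu'
  have hc : C (MvPolynomial.eval a r)⁻¹ * C (MvPolynomial.eval a r) = 1 := by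
    rw [← C_mul, inv_mul_cancel₀ (left_ne_zero_of_mul ha), C_1]
  refine ⟨C (MvPolynomial.eval a r)⁻¹ * u.map (MvPolynomial.eval a),
    C (MvPolynomial.eval a r)⁻¹ * v.map (MvPolynomial.eval a), ?_⟩
  linear_combination (-C (MvPolynomial.eval a r)⁻¹) * hu' + hc

/-- A polynomial coprime to `p` divides some `ν(p)` with `ν(0) ≠ 0`. -/
theorem exists_dvd_comp_of_isCoprime {p h : F[X]} (hp : IsCoprime p h) (h0 : h ≠ 0) :
    ∃ ν : F[X], ν.coeff 0 ≠ 0 ∧ h ∣ ν.comp p := by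
  have : Module.Finite F (AdjoinRoot h) := (AdjoinRoot.powerBasis h0).finite
  obtain ⟨ν, hν, hν0⟩ := Algebra.IsIntegral.isIntegral (R := F) (AdjoinRoot.mk h p)
  -- An integral equation of `p` modulo `h` may vanish at `0`. Its factor `X ^ m` becomes `p ^ m`,
  -- which is coprime to `h` and can be cancelled.
  obtain ⟨μ, hμ, hdvd⟩ := exists_eq_pow_rootMultiplicity_mul_and_not_dvd ν hν.ne_zero 0
  refine ⟨μ, fun h0 => hdvd (by rw [C_0, sub_zero, X_dvd_iff]; exact h0), ?_⟩
  have h1 : h ∣ ν.comp p := by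
    rw [← AdjoinRoot.mk_eq_zero, ← hν0, comp, hom_eval₂]
    rfl
  rw [hμ] at h1
  simp only [C_0, sub_zero, mul_comp, pow_comp, X_comp] at h1
  exact (hp.symm.pow_right).dvd_of_dvd_mul_left h1

end Line

/-! ### Regularity at `ε = 0`, limits, and border computations. -/

section IntegralAtZero

open Polynomial

variable {F : Type*} [Field F] {M S : Type*} [CommRing M] [CommRing S]

/-- The elements of `S` that belong to the image of `M` after multiplication by the image of a
polynomial that does not vanish at `0`. -/
def localRange (φ : M →+* S) (c : F[X] →+* M) : Subring S where
  carrier := {a | ∃ ν : F[X], ν.coeff 0 ≠ 0 ∧ φ (c ν) * a ∈ φ.range}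
  mul_mem' := by
    rintro a b ⟨ν, hν, x, hx⟩ ⟨μ, hμ, y, hy⟩
    refine ⟨ν * μ, by simp [mul_coeff_zero, hν, hμ], x * y, ?_⟩
    simp only [map_mul, hx, hy]; ring
  one_mem' := ⟨1, by simp, 1, by simp⟩
  add_mem' := by
    rintro a b ⟨ν, hν, x, hx⟩ ⟨μ, hμ, y, hy⟩
    refine ⟨ν * μ, by simp [mul_coeff_zero, hν, hμ], c μ * x + c ν * y, ?_⟩
    simp only [map_mul, map_add, hx, hy]; ring
  zero_mem' := ⟨1, by simp, 0, by simp⟩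
  neg_mem' := by
    rintro a ⟨ν, hν, x, hx⟩
    exact ⟨ν, hν, -x, by simp [hx]⟩

theorem apply_mem_localRange (φ : M →+* S) (c : F[X] →+* M) (x : M) : φ x ∈ localRange φ c :=
  ⟨1, by simp, x, by simp⟩

end IntegralAtZero

section Model

open Polynomial

variable (F : Type*) [Field F] (n : ℕ)

/-- The inclusion of `F[ε][x]` in `F(ε)[x]`. -/
noncomputable def fromIntegral :
    MvPolynomial (Fin n) F[X] →+* MvPolynomial (Fin n) (RatFunc F) :=
  MvPolynomial.map (algebraMap F[X] (RatFunc F))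

/-- The inclusion of `F[x]` in `F(ε)[x]`. -/
noncomputable def fromBase : MvPolynomial (Fin n) F →+* MvPolynomial (Fin n) (RatFunc F) :=
  MvPolynomial.map RatFunc.C

/-- The polynomials over `F(ε)` whose coefficients have no pole at `ε = 0`. -/
noncomputable def regularAtZero : Subring (MvPolynomial (Fin n) (RatFunc F)) :=
  localRange (fromIntegral F n) MvPolynomial.C

variable {F n}

theorem fromIntegral_map_C (f : MvPolynomial (Fin n) F) :
    fromIntegral F n (MvPolynomial.map C f) = fromBase F n f := by
  rw [fromIntegral, fromBase, MvPolynomial.map_map]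
  congr 1

theorem fromBase_mem (f : MvPolynomial (Fin n) F) : fromBase F n f ∈ regularAtZero F n := by
  rw [← fromIntegral_map_C]
  exact apply_mem_localRange _ _ _

variable (F n) in
/-- The variable `ε`, as an element of `F(ε)[x]`. -/
noncomputable def eps : MvPolynomial (Fin n) (RatFunc F) := MvPolynomial.C RatFunc.X

theorem fromIntegral_C_X : fromIntegral F n (MvPolynomial.C X) = eps F n := by
  simp [fromIntegral, eps]

theorem eps_mem : eps F n ∈ regularAtZero F n := by
  rw [← fromIntegral_C_X]
  exact apply_mem_localRange _ _ _

/-- `a` tends to `f` for `ε → 0`. -/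
def TendsTo (a : MvPolynomial (Fin n) (RatFunc F)) (f : MvPolynomial (Fin n) F) : Prop :=
  ∃ h ∈ regularAtZero F n, a = fromBase F n f + eps F n * h

theorem TendsTo.add {a b : MvPolynomial (Fin n) (RatFunc F)} {f g : MvPolynomial (Fin n) F}
    (ha : TendsTo a f) (hb : TendsTo b g) : TendsTo (a + b) (f + g) := by
  obtain ⟨h, hh, rfl⟩ := ha
  obtain ⟨h', hh', rfl⟩ := hb
  exact ⟨h + h', add_mem hh hh', by rw [map_add]; ring⟩

theorem TendsTo.mul {a b : MvPolynomial (Fin n) (RatFunc F)} {f g : MvPolynomial (Fin n) F}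
    (ha : TendsTo a f) (hb : TendsTo b g) : TendsTo (a * b) (f * g) := by
  obtain ⟨h, hh, rfl⟩ := ha
  obtain ⟨h', hh', rfl⟩ := hb
  refine ⟨h * fromBase F n g + fromBase F n f * h' + eps F n * (h * h'), ?_, by
    rw [map_mul]; ring⟩
  exact add_mem (add_mem (mul_mem hh (fromBase_mem g)) (mul_mem (fromBase_mem f) hh'))
    (mul_mem eps_mem (mul_mem hh hh'))

theorem tendsTo_fromBase (f : MvPolynomial (Fin n) F) : TendsTo (fromBase F n f) f :=
  ⟨0, zero_mem _, by simp⟩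

theorem TendsTo.sum {ι : Type*} (s : Finset ι) {a : ι → MvPolynomial (Fin n) (RatFunc F)}
    {f : ι → MvPolynomial (Fin n) F} (h : ∀ i ∈ s, TendsTo (a i) (f i)) :
    TendsTo (∑ i ∈ s, a i) (∑ i ∈ s, f i) := by
  classical
  induction s using Finset.induction_on with
  | empty => simpa using tendsTo_fromBase (0 : MvPolynomial (Fin n) F)
  | insert i s hi ih =>
    rw [Finset.sum_insert hi, Finset.sum_insert hi]
    exact (h i (by simp)).add (ih fun j hj => h j (by simp [hj]))

/-- `f` is the limit for `ε → 0` of polynomials over `F(ε)` that are computed in `k` steps. -/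
def BorderCost (k : ℕ) (f : MvPolynomial (Fin n) F) : Prop :=
  ∃ a, Cost (leaves (RatFunc F) n) k {a} ∧ TendsTo a f

theorem BorderCost.mono {k l : ℕ} {f : MvPolynomial (Fin n) F} (h : BorderCost k f) (hk : k ≤ l) :
    BorderCost l f :=
  let ⟨a, ha, hf⟩ := h
  ⟨a, ha.mono_cost hk, hf⟩

theorem BorderCost.mul {k l : ℕ} {f g : MvPolynomial (Fin n) F} (h : BorderCost k f)
    (h' : BorderCost l g) : BorderCost (k + l + 1) (f * g) :=
  let ⟨a, ha, hf⟩ := h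
  let ⟨b, hb, hg⟩ := h'
  ⟨a * b, ha.mul' hb, hf.mul hg⟩

theorem borderCost_C (c : F) : BorderCost 0 (MvPolynomial.C c : MvPolynomial (Fin n) F) :=
  ⟨_, .of_subset (Set.singleton_subset_iff.2 (Or.inl ⟨RatFunc.C c, by simp [fromBase]⟩)),
    tendsTo_fromBase _⟩

/-- Clearing a denominator that does not vanish at `0`. -/
theorem BorderCost.borderSize_le {k : ℕ} {f : MvPolynomial (Fin n) F} (h : BorderCost k f) :
    borderSize f ≤ ((2 * (k + 1) : ℕ) : ℕ∞) := by
  obtain ⟨a, ha, h, ⟨ν, hν, w, hw⟩, rfl⟩ := h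
  have hC : MvPolynomial.C (algebraMap F[X] (RatFunc F) (C (ν.coeff 0)⁻¹ * ν)) ∈
      leaves (RatFunc F) n := Or.inl ⟨_, rfl⟩
  obtain ⟨D, hD, hcomp⟩ := (ha.trans_right
    (Cost.mul (Or.inl hC) (Or.inr (Set.mem_singleton _)))).exists_circuit
  refine (iInf₂_le_of_le D ?_ le_rfl).trans (by exact_mod_cast hD)
  -- Scaled to constant term `1`, the denominator is `1 + ε * (...)`. Multiplying by it clears the
  -- pole-free error term and changes `f` only by a multiple of `ε`.
  have hν1 : C (ν.coeff 0)⁻¹ * ν = 1 + X * (C (ν.coeff 0)⁻¹ * ν.divX) := by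
    have h1 : C (ν.coeff 0)⁻¹ * C (ν.coeff 0) = 1 := by rw [← C_mul, inv_mul_cancel₀ hν, C_1]
    linear_combination (-C (ν.coeff 0)⁻¹) * X_mul_divX_add ν + h1
  refine ⟨MvPolynomial.C (C (ν.coeff 0)⁻¹ * ν.divX) * MvPolynomial.map C f +
    MvPolynomial.C (C (ν.coeff 0)⁻¹) * w, ?_⟩
  suffices hh : MvPolynomial.C (algebraMap F[X] (RatFunc F) (C (ν.coeff 0)⁻¹ * ν)) *
      (fromBase F n f + eps F n * h) = fromBase F n f + eps F n * fromIntegral F n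
        (MvPolynomial.C (C (ν.coeff 0)⁻¹ * ν.divX) * MvPolynomial.map C f +
          MvPolynomial.C (C (ν.coeff 0)⁻¹) * w) from hcomp.trans hh
  have e1 : ∀ p : F[X], MvPolynomial.C (algebraMap F[X] (RatFunc F) p) =
      fromIntegral F n (MvPolynomial.C p) := fun p => by simp [fromIntegral]
  rw [e1, mul_add]
  have e2 : fromIntegral F n (MvPolynomial.C (C (ν.coeff 0)⁻¹ * ν)) * (eps F n * h) =
      eps F n * fromIntegral F n (MvPolynomial.C (C (ν.coeff 0)⁻¹) * w) := by
    rw [map_mul, map_mul, map_mul, hw]; ring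
  rw [e2, hν1, ← fromIntegral_map_C, ← fromIntegral_C_X]
  simp only [map_add, map_mul, map_one]
  ring

end Model

/-! ### The extension by a root `Y` of `p(Y) = ε`, and its coordinates. -/

section Extension

open Polynomial

variable {F : Type*} [Field F] (n : ℕ) (p : F[X])

/-- The polynomial `p(Y) - ε` over `F[ε][x]`. -/
noncomputable def integralModulus : (MvPolynomial (Fin n) F[X])[X] :=
  p.map ((MvPolynomial.C).comp C) - C (MvPolynomial.C X)

/-- The polynomial `p(Y) - ε` over `F(ε)[x]`. -/
noncomputable def modulus : (MvPolynomial (Fin n) (RatFunc F))[X] :=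
  (integralModulus n p).map (fromIntegral F n)

/-- The ring `F(ε)[x][Y] / (p(Y) - ε)`. -/
abbrev Extension := AdjoinRoot (modulus n p)

/-- The canonical map from `F[ε][x][Y]`. -/
noncomputable def extIntegral : (MvPolynomial (Fin n) F[X])[X] →+* Extension n p :=
  (AdjoinRoot.mk (modulus n p)).comp (mapRingHom (fromIntegral F n))

/-- The canonical map from `F[x][Y]`. -/
noncomputable def extBase : (MvPolynomial (Fin n) F)[X] →+* Extension n p :=
  (AdjoinRoot.mk (modulus n p)).comp (mapRingHom (fromBase F n))

/-- The canonical map from `F(ε)[Y]`. -/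
noncomputable def extConst : (RatFunc F)[X] →+* Extension n p :=
  (AdjoinRoot.mk (modulus n p)).comp (mapRingHom MvPolynomial.C)

/-- The elements without pole at `ε = 0`. -/
noncomputable def regularExt : Subring (Extension n p) :=
  localRange (F := F) (M := (MvPolynomial (Fin n) F[X])[X]) (extIntegral n p)
    ((C : MvPolynomial (Fin n) F[X] →+* _).comp MvPolynomial.C)

variable {n p}

theorem integralModulus_monic (hp : p.Monic) (hp0 : 0 < p.natDegree) :
    (integralModulus n p).Monic := by
  refine (hp.map _).sub_of_left ?_
  refine degree_C_le.trans_lt ?_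
  rw [hp.degree_map]
  exact natDegree_pos_iff_degree_pos.1 hp0

theorem modulus_monic (hp : p.Monic) (hp0 : 0 < p.natDegree) : (modulus n p).Monic :=
  (integralModulus_monic hp hp0).map _

theorem natDegree_modulus (hp : p.Monic) (hp0 : 0 < p.natDegree) :
    (modulus n p).natDegree = p.natDegree := by
  rw [modulus, (integralModulus_monic hp hp0).natDegree_map, integralModulus, natDegree_sub_C,
    hp.natDegree_map]

/-- The modulus does not involve `x`, so the structure constants of the extension are scalars in
`F(ε)` and free for circuits. -/
theorem modulus_eq_map :
    modulus n p = (p.map RatFunc.C - C RatFunc.X).map (MvPolynomial.C : _ →+*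
      MvPolynomial (Fin n) (RatFunc F)) := by
  simp only [modulus, integralModulus, Polynomial.map_sub, Polynomial.map_map, map_C]
  congr 2
  · ext c
    simp [fromIntegral]
  · simp [fromIntegral]

theorem extIntegral_map (f : (MvPolynomial (Fin n) F)[X]) :
    extIntegral n p (f.map (MvPolynomial.map C)) = extBase n p f := by
  simp only [extIntegral, extBase, RingHom.comp_apply, coe_mapRingHom, Polynomial.map_map]
  congr 2
  exact RingHom.ext fromIntegral_map_C

theorem extConst_map (f : F[X]) :
    extConst n p (f.map RatFunc.C) = extBase n p (f.map MvPolynomial.C) := by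
  simp only [extConst, extBase, RingHom.comp_apply, coe_mapRingHom, Polynomial.map_map]
  congr 2
  ext x : 1
  simp [fromBase]

theorem extBase_mem (f : (MvPolynomial (Fin n) F)[X]) : extBase n p f ∈ regularExt n p := by
  refine ⟨1, by simp, f.map (MvPolynomial.map C), ?_⟩
  rw [map_one, map_one, one_mul, extIntegral_map]

theorem extBase_map_p :
    extBase n p (p.map MvPolynomial.C) = AdjoinRoot.of (modulus n p) (eps F n) := by
  rw [extBase, RingHom.comp_apply, coe_mapRingHom, Polynomial.map_map, ← AdjoinRoot.mk_C,
    AdjoinRoot.mk_eq_mk, modulus_eq_map]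
  simp only [Polynomial.map_sub, Polynomial.map_map, map_C]
  refine dvd_of_eq ?_
  congr 2
  ext c
  simp [fromBase]

/-- In the quotient `ε = p(Y)`. Thus a multiple `ν(p)` of a polynomial in `Y` becomes the scalar
`ν(ε)`, which yields inverses. -/
theorem extIntegral_C_C (ν : F[X]) :
    extIntegral n p (C (MvPolynomial.C ν)) = extBase n p ((ν.comp p).map MvPolynomial.C) := by
  induction ν using Polynomial.induction_on' with
  | add a b ha hb => simp only [map_add, ha, hb, add_comp, Polynomial.map_add]
  | monomial k c =>
    have h1 : extIntegral n p (C (MvPolynomial.C X)) = extBase n p (p.map MvPolynomial.C) := by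
      rw [extBase_map_p, extIntegral, RingHom.comp_apply, coe_mapRingHom, map_C, fromIntegral_C_X]
      rfl
    have h2 : extIntegral n p (C (MvPolynomial.C (C c))) = extBase n p (C (MvPolynomial.C c)) := by
      rw [← extIntegral_map]; simp
    simp only [← C_mul_X_pow_eq_monomial, map_mul, map_pow, h1, h2, mul_comp, C_comp, pow_comp,
      X_comp, Polynomial.map_mul, Polynomial.map_pow, map_C]

variable (n) in
/-- The coordinates with respect to the powers of `Y`. -/
noncomputable def coord (hp : p.Monic) (hp0 : 0 < p.natDegree) (k : ℕ) :
    Extension n p →ₗ[MvPolynomial (Fin n) (RatFunc F)] MvPolynomial (Fin n) (RatFunc F) :=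
  (lcoeff _ k).comp (AdjoinRoot.modByMonicHom (modulus_monic hp hp0))

variable (hp : p.Monic) (hp0 : 0 < p.natDegree)

theorem coord_mk (k : ℕ) (f : (MvPolynomial (Fin n) (RatFunc F))[X]) :
    coord n hp hp0 k (AdjoinRoot.mk _ f) = (f %ₘ modulus n p).coeff k := by
  simp [coord]

/-- Below the degree of the modulus no reduction takes place, so no power of `ε` enters. -/
theorem coord_extBase (k : ℕ) (f : (MvPolynomial (Fin n) F)[X]) (hf : f.natDegree < p.natDegree) :
    coord n hp hp0 k (extBase n p f) = fromBase F n (f.coeff k) := by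
  have h1 := modulus_monic (n := n) hp hp0
  nontriviality MvPolynomial (Fin n) (RatFunc F)
  rw [extBase, RingHom.comp_apply, coord_mk, (modByMonic_eq_self_iff h1).2, coe_mapRingHom,
    coeff_map]
  refine degree_lt_degree (natDegree_map_le.trans_lt ?_)
  rwa [natDegree_modulus hp hp0]

theorem coord_extIntegral_mem (k : ℕ) (f : (MvPolynomial (Fin n) F[X])[X]) :
    coord n hp hp0 k (extIntegral n p f) ∈ (fromIntegral F n).range := by
  rw [extIntegral, RingHom.comp_apply, coord_mk, coe_mapRingHom, modulus,
    ← map_modByMonic _ (integralModulus_monic hp hp0), coeff_map]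
  exact ⟨_, rfl⟩

theorem coord_extConst_mem (k : ℕ) (f : (RatFunc F)[X]) :
    coord n hp hp0 k (extConst n p f) ∈ Set.range MvPolynomial.C := by
  have hmonic : (p.map RatFunc.C - C RatFunc.X).Monic := by
    refine (hp.map _).sub_of_left (degree_C_le.trans_lt ?_)
    rw [hp.degree_map]
    exact natDegree_pos_iff_degree_pos.1 hp0
  rw [extConst, RingHom.comp_apply, coord_mk, coe_mapRingHom, modulus_eq_map,
    ← map_modByMonic _ hmonic, coeff_map]
  exact ⟨_, rfl⟩

/-- The modulus is monic over `F[ε][x]`, so remainders acquire no denominators; the scalar `ν(ε)`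
passes through the linear coordinate map. -/
theorem coord_mem_regularAtZero (k : ℕ) {x : Extension n p} (hx : x ∈ regularExt n p) :
    coord n hp hp0 k x ∈ regularAtZero F n := by
  obtain ⟨ν, hν, w, hw⟩ := hx
  refine ⟨ν, hν, ?_⟩
  have h1 : extIntegral n p (((C : MvPolynomial (Fin n) F[X] →+* _).comp MvPolynomial.C) ν) * x =
      fromIntegral F n (MvPolynomial.C ν) • x := by
    rw [Algebra.smul_def]; congr 1
    simp only [extIntegral, RingHom.comp_apply, coe_mapRingHom, map_C]
    rfl
  rw [← smul_eq_mul, ← map_smul, ← h1, ← hw]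
  exact coord_extIntegral_mem hp hp0 k w

theorem coord_mul (i : ℕ) (a b : Extension n p) :
    coord n hp hp0 i (a * b) = ∑ j : Fin p.natDegree, ∑ j' : Fin p.natDegree,
      coord n hp hp0 i (extConst n p (X ^ (j + j' : ℕ))) *
        (coord n hp hp0 j a * coord n hp hp0 j' b) := by
  have h1 := modulus_monic (n := n) hp hp0
  have expand : ∀ a : Extension n p,
      a = ∑ j : Fin p.natDegree, coord n hp hp0 j a • AdjoinRoot.root (modulus n p) ^ (j : ℕ) := by
    intro a
    obtain ⟨f, rfl⟩ := AdjoinRoot.mk_surjective a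
    have h2 : f %ₘ modulus n p = ∑ j : Fin p.natDegree,
        C ((f %ₘ modulus n p).coeff j) * X ^ (j : ℕ) := by
      rw [Fin.sum_univ_eq_sum_range (fun j => C ((f %ₘ modulus n p).coeff j) * X ^ j)]
      refine as_sum_range_C_mul_X_pow' _ ?_
      have h3 := natDegree_modByMonic_lt f h1 (by
        intro h; have := natDegree_modulus (n := n) hp hp0; rw [h, natDegree_one] at this; omega)
      rwa [natDegree_modulus hp hp0] at h3
    have h4 : AdjoinRoot.mk (modulus n p) f = AdjoinRoot.mk (modulus n p) (f %ₘ modulus n p) := by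
      rw [AdjoinRoot.mk_eq_mk]
      exact ⟨f /ₘ modulus n p, by linear_combination -modByMonic_add_div f (modulus n p)⟩
    rw [h4]
    conv_lhs => rw [h2]
    rw [map_sum, ← h4]
    refine Finset.sum_congr rfl fun j _ => ?_
    rw [coord_mk, map_mul, map_pow, AdjoinRoot.mk_X, AdjoinRoot.mk_C, Algebra.smul_def]
    rfl
  conv_lhs => rw [expand a, expand b, Finset.sum_mul_sum, map_sum]
  refine Finset.sum_congr rfl fun j _ => ?_
  rw [map_sum]
  refine Finset.sum_congr rfl fun j' _ => ?_
  rw [smul_mul_smul_comm, map_smul, ← pow_add, smul_eq_mul, mul_comm]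
  simp [extConst]

/-- Simulation over `F(ε)[x]` of a computation in the extension. -/
theorem Cost.of_extension {B : Set (MvPolynomial (Fin n) (RatFunc F))} {B' V : Set (Extension n p)}
    {k : ℕ} (hB : Set.range MvPolynomial.C ⊆ B)
    (hB' : ∀ (i : ℕ), ∀ b ∈ B', coord n hp hp0 i b ∈ B) (h : Cost B' k V) :
    Cost B (k * (4 * p.natDegree ^ 3 + 1)) (coord n hp hp0 0 '' V) := by
  have := h.coords (B := B) (fun i : Fin p.natDegree => coord n hp hp0 i)
    (fun i j j' => coord n hp hp0 i (extConst n p (X ^ (j + j' : ℕ))))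
    (fun i a b => map_add _ _ _) (fun i a b => coord_mul hp hp0 i a b)
    (fun i j j' => hB (coord_extConst_mem hp hp0 _ _)) (hB ⟨0, by simp⟩)
    (fun i b hb => hB' i b hb)
  rw [Fintype.card_fin] at this
  exact this.mono subset_rfl le_rfl
    (Set.subset_iUnion (fun i : Fin p.natDegree => (coord n hp hp0 i) '' V) ⟨0, hp0⟩)

end Extension

/-! ### Expansion in `T` around a point of the line. -/

section Spread

open Polynomial

variable {F : Type*} [Field F] {n : ℕ}

/-- Substitution of a plane that contains the line through `a` with direction `b` and, for `Y = 0`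
and `T = 1`, the generic point. -/
noncomputable def spread (a b : Fin n → F) :
    MvPolynomial (Fin n) F →ₐ[F] (MvPolynomial (Fin n) F)[X][X] :=
  MvPolynomial.aeval fun j => C (C (MvPolynomial.C (a j)) + C (MvPolynomial.C (b j)) * X) +
    X * C (C (MvPolynomial.X j - MvPolynomial.C (a j)))

theorem spread_X (a b : Fin n → F) (j : Fin n) : spread a b (MvPolynomial.X j) =
    C (C (MvPolynomial.C (a j)) + C (MvPolynomial.C (b j)) * X) +
    X * C (C (MvPolynomial.X j - MvPolynomial.C (a j))) := by simp [spread]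

theorem spread_C (a b : Fin n → F) (c : F) :
    spread a b (MvPolynomial.C c) = C (C (MvPolynomial.C c)) := by
  rw [← MvPolynomial.algebraMap_eq, AlgHom.commutes]; rfl

theorem spread_coeff_zero (a b : Fin n → F) (f : MvPolynomial (Fin n) F) :
    (spread a b f).coeff 0 = (line a b f).map MvPolynomial.C := by
  induction f using MvPolynomial.induction_on with
  | C c => rw [spread_C]; simp [line]
  | add f g hf hg => simp [hf, hg]
  | mul_X f j hf => rw [map_mul, map_mul, mul_coeff_zero, hf, spread_X]; simp [line]

theorem coeff_coeff_mul_eq_zero {R : Type*} [CommRing R] {q r : R[X][X]} {D E : ℕ}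
    (hq : ∀ i k, D < i + k → (q.coeff i).coeff k = 0)
    (hr : ∀ i k, E < i + k → (r.coeff i).coeff k = 0) (i k : ℕ) (h : D + E < i + k) :
    ((q * r).coeff i).coeff k = 0 := by
  rw [coeff_mul, finsetSum_coeff]
  refine Finset.sum_eq_zero fun x hx => ?_
  rw [coeff_mul]
  refine Finset.sum_eq_zero fun y hy => ?_
  rw [Finset.HasAntidiagonal.mem_antidiagonal] at hx hy
  by_cases h1 : D < x.1 + y.1
  · rw [hq _ _ h1, zero_mul]
  · rw [hr _ _ (by omega), mul_zero]

/-- The variables go to polynomials of total degree at most one in `Y` and `T` jointly. -/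
theorem spread_coeff_coeff (a b : Fin n → F) {f : MvPolynomial (Fin n) F} {D : ℕ}
    (hf : f.totalDegree ≤ D) (i k : ℕ) (h : D < i + k) :
    ((spread a b f).coeff i).coeff k = 0 := by
  have hX : ∀ j, ∀ i k, 1 < i + k → ((spread a b (MvPolynomial.X j)).coeff i).coeff k = 0 := by
    intro j i k hik
    rw [spread_X]
    rcases i with _ | _ | i
    · have h1 : k ≠ 0 := by omega
      have h2 : 1 ≠ k := by omega
      simp [coeff_C, coeff_X, h1, h2]
    · have h1 : k ≠ 0 := by omega
      simp [coeff_C, h1]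
    · simp [coeff_X_mul]
  have hpow : ∀ j m, ∀ i k, m < i + k →
      ((spread a b (MvPolynomial.X j) ^ m).coeff i).coeff k = 0 := by
    intro j m
    induction m with
    | zero =>
      intro i k hik
      rw [pow_zero, coeff_one]
      split_ifs with h0
      · rw [coeff_one, if_neg (by omega)]
      · rw [coeff_zero]
    | succ m ih => rw [pow_succ]; exact coeff_coeff_mul_eq_zero ih (hX j)
  have hprod : ∀ (m : Fin n →₀ ℕ) (s : Finset (Fin n)), ∀ i k, ∑ j ∈ s, m j < i + k →
      ((∏ j ∈ s, spread a b (MvPolynomial.X j) ^ m j).coeff i).coeff k = 0 := by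
    intro m s
    induction s using Finset.induction_on with
    | empty =>
      intro i k hik
      rw [Finset.prod_empty, coeff_one]
      split_ifs with h0
      · rw [coeff_one, if_neg (by simp at hik; omega)]
      · rw [coeff_zero]
    | insert j s hj ih =>
      rw [Finset.prod_insert hj, Finset.sum_insert hj]
      exact coeff_coeff_mul_eq_zero (hpow j _) ih
  rw [f.as_sum, map_sum, finsetSum_coeff, finsetSum_coeff]
  refine Finset.sum_eq_zero fun m hm => ?_
  have hdeg : ∑ j, m j ≤ D := by
    refine le_trans ?_ ((MvPolynomial.le_totalDegree hm).trans hf)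
    rw [Finsupp.sum_fintype _ _ (fun _ => rfl)]
  rw [MvPolynomial.monomial_eq, map_mul, spread_C, Finsupp.prod_fintype _ _ (fun _ => pow_zero _),
    map_prod, coeff_C_mul, coeff_C_mul]
  simp only [map_pow]
  rw [hprod m Finset.univ i k (by omega), mul_zero]

/-- At `Y = 0` and `T = 1` the substitution is `x ↦ a + (x - a) = x`. -/
theorem spread_sum_coeff_coeff_zero (a b : Fin n → F) {f : MvPolynomial (Fin n) F} {D : ℕ}
    (hf : f.totalDegree ≤ D) :
    ∑ i ∈ Finset.range (D + 1), ((spread a b f).coeff i).coeff 0 = f := by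
  have h1 : ∀ f, ((spread a b f).map (evalRingHom 0)).eval 1 = f := by
    intro f
    induction f using MvPolynomial.induction_on with
    | C c => rw [spread_C]; simp
    | add f g hf hg => simp only [map_add, Polynomial.map_add, eval_add, hf, hg]
    | mul_X f j hf => rw [map_mul, Polynomial.map_mul, eval_mul, hf, spread_X]; simp
  conv_rhs => rw [← h1 f]
  rw [eval_eq_sum_range' (n := D + 1)]
  · simp [coeff_zero_eq_eval_zero]
  · rw [Nat.lt_succ_iff, natDegree_le_iff_coeff_eq_zero]
    intro i hi
    rw [coeff_map, coe_evalRingHom, ← coeff_zero_eq_eval_zero]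
    exact spread_coeff_coeff a b hf i 0 (by omega)

end Spread

/-! ### Coefficients of logarithmic derivatives with explicit denominators. -/

section LogDerivative

open Polynomial

variable {R : Type*} [CommRing R]

/-- The numerators of the coefficients of the logarithmic derivative of `q`, whose denominators are
the powers of the constant term of `q`. -/
theorem exists_logDerivative_numerators {q : R[X][X]} {d : ℕ} (hd : 1 ≤ d)
    (hq : ∀ i k, d < i + k → (q.coeff i).coeff k = 0) :
    ∃ u : ℕ → R[X], (∀ i, (u i).natDegree ≤ (i + 1) * (d - 1)) ∧
      ∀ i, u i + ∑ x ∈ Finset.range i, u x * (q.coeff (i - x) * q.coeff 0 ^ (i - x - 1)) =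
        (i + 1) * (q.coeff (i + 1) * q.coeff 0 ^ i) := by
  obtain ⟨m, rfl⟩ := Nat.exists_eq_add_of_le' hd
  rw [Nat.add_sub_cancel]
  have h0 : (q.coeff 0).natDegree ≤ m + 1 :=
    natDegree_le_iff_coeff_eq_zero.2 fun k hk => hq 0 k (by omega)
  -- The coefficient of `T ^ (k + 1)` has degree at most `d - k - 1` in `Y`, so the product has
  -- degree at most `(d - k - 1) + k * d = (k + 1) * (d - 1)`.
  have hdeg : ∀ k, (q.coeff (k + 1) * q.coeff 0 ^ k).natDegree ≤ (k + 1) * m := by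
    intro k
    by_cases hk : k ≤ m
    · have h1 : (q.coeff (k + 1)).natDegree ≤ m - k :=
        natDegree_le_iff_coeff_eq_zero.2 fun l hl => hq _ l (by omega)
      refine (natDegree_mul_le_of_le h1 (natDegree_pow_le_of_le k h0)).trans ?_
      obtain ⟨c, rfl⟩ := Nat.exists_eq_add_of_le hk
      rw [Nat.add_sub_cancel_left]
      nlinarith
    · have h1 : q.coeff (k + 1) = 0 := by
        ext l
        exact hq _ l (by omega)
      simp [h1]
  let u : ℕ → R[X] := fun i => Nat.strongRec (fun i u =>
    (i + 1) * (q.coeff (i + 1) * q.coeff 0 ^ i) - ∑ x : Fin i, u x x.isLt *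
      (q.coeff (i - x) * q.coeff 0 ^ (i - x - 1))) i
  have hu : ∀ i, u i = (i + 1) * (q.coeff (i + 1) * q.coeff 0 ^ i) - ∑ x ∈ Finset.range i, u x *
      (q.coeff (i - x) * q.coeff 0 ^ (i - x - 1)) := by
    intro i
    rw [← Fin.sum_univ_eq_sum_range
      (fun x => u x * (q.coeff (i - x) * q.coeff 0 ^ (i - x - 1)))]
    simp only [u]
    rw [Nat.strongRec]
  refine ⟨u, fun i => ?_, fun i => by rw [hu i]; ring⟩
  induction i using Nat.strong_induction_on with
  | _ i ih =>
    rw [hu]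
    refine (natDegree_sub_le _ _).trans (max_le ?_ (natDegree_sum_le_of_forall_le _ _ ?_))
    · have : ((i : R[X]) + 1) = ((i + 1 : ℕ) : R[X]) := by push_cast; rfl
      rw [this, ← nsmul_eq_mul]
      exact (natDegree_smul_le _ _).trans (hdeg i)
    · intro x hx
      have hx := Finset.mem_range.1 hx
      obtain ⟨c, rfl⟩ := Nat.exists_eq_add_of_lt hx
      have h2 := hdeg c
      rw [show x + c + 1 - x = c + 1 by omega, Nat.add_sub_cancel]
      exact (natDegree_mul_le_of_le (ih x hx) h2).trans (le_of_eq (by ring))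

/-- With `χ` arbitrary, the same numerators serve in the extension and at `Y = 0`; this links the
two logarithmic derivatives in the limit. -/
theorem logDerivative_mul {S : Type*} [CommRing S] {q : R[X][X]} {u : ℕ → R[X]}
    (hu : ∀ i, u i + ∑ x ∈ Finset.range i, u x * (q.coeff (i - x) * q.coeff 0 ^ (i - x - 1)) =
        (i + 1) * (q.coeff (i + 1) * q.coeff 0 ^ i)) (χ : R[X] →+* S) {γ : S}
    (hγ : χ (q.coeff 0) * γ = 1) :
    PowerSeries.mk (fun i => χ (u i) * γ ^ (i + 1)) * PowerSeries.map χ (q : PowerSeries R[X]) =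
      PowerSeries.derivative S (PowerSeries.map χ (q : PowerSeries R[X])) := by
  have hpow : ∀ k, χ (q.coeff 0) ^ k * γ ^ k = 1 := fun k => by rw [← mul_pow, hγ, one_pow]
  ext i
  rw [PowerSeries.coeff_mul, Finset.Nat.sum_antidiagonal_eq_sum_range_succ_mk,
    Finset.sum_range_succ, PowerSeries.coeff_derivative]
  simp only [PowerSeries.coeff_mk, PowerSeries.coeff_map, Polynomial.coeff_coe]
  have h := congrArg (fun v => χ v * γ ^ i) (hu i)
  simp only [map_add, map_mul, map_sum, map_pow, map_natCast, map_one, add_mul,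
    Finset.sum_mul] at h
  rw [Nat.sub_self, ← map_natCast χ]
  simp only [map_natCast]
  have h1 : χ (u i) * γ ^ (i + 1) * χ (q.coeff 0) = χ (u i) * γ ^ i := by
    rw [pow_succ]; linear_combination χ (u i) * γ ^ i * hγ
  have h2 : ∑ x ∈ Finset.range i, χ (u x) * γ ^ (x + 1) * χ (q.coeff (i - x)) =
      ∑ x ∈ Finset.range i,
        χ (u x) * (χ (q.coeff (i - x)) * χ (q.coeff 0) ^ (i - x - 1)) * γ ^ i := by
    refine Finset.sum_congr rfl fun x hx => ?_
    have hx := Finset.mem_range.1 hx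
    obtain ⟨c, rfl⟩ := Nat.exists_eq_add_of_lt hx
    rw [show x + c + 1 - x = c + 1 by omega, Nat.add_sub_cancel,
      show γ ^ (x + c + 1) = γ ^ (x + 1) * γ ^ c by ring]
    linear_combination (-χ (u x) * χ (q.coeff (c + 1)) * γ ^ (x + 1)) * hpow c
  rw [h1, h2]
  linear_combination h + (i + 1) * χ (q.coeff (i + 1)) * hpow i

end LogDerivative

/-! ### The limit of the logarithmic derivative. -/

section Limit

open Polynomial

theorem PowerSeries.derivative_map {R S : Type*} [CommRing R] [CommRing S] (φ : R →+* S)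
    (f : PowerSeries R) : PowerSeries.derivative S (PowerSeries.map φ f) =
      PowerSeries.map φ (PowerSeries.derivative R f) := by
  ext i
  simp [PowerSeries.coeff_derivative]

/-- A power series over a subring with invertible constant term has its logarithmic derivative over
that subring. -/
theorem exists_logDerivative_mem {S : Type*} [CommRing S] (T : Subring S) (f : PowerSeries S)
    (hf : ∀ i, PowerSeries.coeff i f ∈ T) {γ : S} (hγT : γ ∈ T)
    (hγ : PowerSeries.coeff 0 f * γ = 1) :
    ∃ L : PowerSeries S, (∀ i, PowerSeries.coeff i L ∈ T) ∧
      L * f = PowerSeries.derivative S f := by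
  let f' : PowerSeries T := PowerSeries.mk fun i => ⟨PowerSeries.coeff i f, hf i⟩
  have hf' : PowerSeries.map T.subtype f' = f := by
    ext i
    simp [f']
  let v : Tˣ := Units.mkOfMulEqOne ⟨_, hf 0⟩ ⟨γ, hγT⟩ (Subtype.ext hγ)
  have hv : f' * PowerSeries.invOfUnit f' v = 1 := PowerSeries.mul_invOfUnit _ _ (by
    rw [← PowerSeries.coeff_zero_eq_constantCoeff_apply, PowerSeries.coeff_mk]; rfl)
  refine ⟨PowerSeries.map T.subtype (PowerSeries.derivative T f' * PowerSeries.invOfUnit f' v),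
    fun i => ?_, ?_⟩
  · rw [PowerSeries.coeff_map]
    exact Subtype.property _
  · conv_lhs => rw [← hf']
    rw [← map_mul, mul_assoc, mul_comm _ f', hv, mul_one, ← PowerSeries.derivative_map, hf']

theorem logDerivative_pow_mul {S : Type*} [CommRing S] {f g L M : PowerSeries S} (e : ℕ)
    (hf : L * f = PowerSeries.derivative S f) (hg : M * g = PowerSeries.derivative S g) :
    ((e : PowerSeries S) * L + M) * (f ^ e * g) = PowerSeries.derivative S (f ^ e * g) := by
  have h1 : PowerSeries.derivative S (f ^ e) = (e : PowerSeries S) * L * f ^ e := by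
    rw [Derivation.leibniz_pow, ← hf]
    cases e with
    | zero => simp
    | succ e =>
      rw [Nat.add_sub_cancel, nsmul_eq_mul, smul_eq_mul, pow_succ]; ring
  rw [Derivation.leibniz, h1, ← hg, smul_eq_mul, smul_eq_mul]
  ring

variable {F : Type*} [Field F] {n : ℕ}

/-- The substitution `spread`, with power series over the extension as values. -/
noncomputable def spreadSeries (a b : Fin n → F) (p : F[X]) :
    MvPolynomial (Fin n) F →+* PowerSeries (Extension n p) :=
  (PowerSeries.map (extBase n p)).comp
    (Polynomial.coeToPowerSeries.ringHom.comp (spread a b).toRingHom)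

theorem spreadSeries_apply (a b : Fin n → F) (p : F[X]) (f : MvPolynomial (Fin n) F) :
    spreadSeries a b p f =
      PowerSeries.map (extBase n p) ((spread a b f : (MvPolynomial (Fin n) F)[X][X]) :
        PowerSeries (MvPolynomial (Fin n) F)[X]) := rfl

theorem coeff_spreadSeries (a b : Fin n → F) (p : F[X]) (f : MvPolynomial (Fin n) F) (i : ℕ) :
    PowerSeries.coeff i (spreadSeries a b p f) = extBase n p ((spread a b f).coeff i) := by
  rw [spreadSeries_apply, PowerSeries.coeff_map, Polynomial.coeff_coe]

theorem of_C_eq_extConst (p : F[X]) (c : RatFunc F) :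
    AdjoinRoot.of (modulus n p) (MvPolynomial.C c) = extConst n p (C c) := by
  simp [extConst]

/-- A polynomial coprime to `p` is invertible in the extension, with an inverse that has no pole at
`ε = 0`. -/
theorem exists_inverse_of_isCoprime {p h : F[X]} (hc : IsCoprime p h) (h0 : h ≠ 0) :
    ∃ γ, γ ∈ Set.range (extConst n p) ∧ γ ∈ regularExt n p ∧
      extBase n p (h.map MvPolynomial.C) * γ = 1 := by
  obtain ⟨ν, hν, k, hk⟩ := exists_dvd_comp_of_isCoprime hc h0
  have hν0 : algebraMap F[X] (RatFunc F) ν ≠ 0 := by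
    rw [Ne, FaithfulSMul.algebraMap_eq_zero_iff]
    rintro rfl
    simp at hν
  have h1 : extIntegral n p (C (MvPolynomial.C ν)) =
      AdjoinRoot.of (modulus n p) (MvPolynomial.C (algebraMap F[X] (RatFunc F) ν)) := by
    simp [extIntegral, fromIntegral]
  have h2 : AdjoinRoot.of (modulus n p) (MvPolynomial.C (algebraMap F[X] (RatFunc F) ν)) *
      AdjoinRoot.of (modulus n p) (MvPolynomial.C (algebraMap F[X] (RatFunc F) ν)⁻¹) = 1 := by
    rw [← map_mul, ← map_mul, mul_inv_cancel₀ hν0, map_one, map_one]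
  have h3 := extIntegral_C_C (n := n) (p := p) ν
  rw [hk, Polynomial.map_mul, map_mul, h1] at h3
  refine ⟨extBase n p (k.map MvPolynomial.C) *
    AdjoinRoot.of (modulus n p) (MvPolynomial.C (algebraMap F[X] (RatFunc F) ν)⁻¹), ?_, ?_, ?_⟩
  · rw [← extConst_map, of_C_eq_extConst, ← map_mul]
    exact ⟨_, rfl⟩
  · refine ⟨ν, hν, (k.map MvPolynomial.C).map (MvPolynomial.map C), ?_⟩
    rw [extIntegral_map, RingHom.comp_apply, h1]
    linear_combination (-extBase n p (k.map MvPolynomial.C)) * h2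
  · rw [← mul_assoc, ← h3, h2]

/-- The logarithmic derivative of `g` is the limit of a coordinate of the logarithmic derivative of
`g ^ e * h`. -/
theorem exists_logDerivative_limit [CharZero F] (a b : Fin n → F) {g h : MvPolynomial (Fin n) F}
    {d e : ℕ} (hd : 1 ≤ d) (hgd : g.totalDegree ≤ d) (he : e ≠ 0) (ha : MvPolynomial.eval a g ≠ 0)
    (hcop : IsCoprime (line a b g) (line a b h))
    (hp : (line a b g ^ d).Monic) (hp0 : 0 < (line a b g ^ d).natDegree)
    (hpd : (line a b g ^ d).natDegree = d * d) :
    ∃ (π : Extension n (line a b g ^ d)) (L : PowerSeries (Extension n (line a b g ^ d)))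
      (l : ℕ → MvPolynomial (Fin n) F) (κ : RatFunc F),
      π ∈ Set.range (extConst n (line a b g ^ d)) ∧
      PowerSeries.coeff 0 (spreadSeries a b (line a b g ^ d) (g ^ e * h)) * π = 1 ∧
      L * spreadSeries a b (line a b g ^ d) (g ^ e * h) =
        PowerSeries.derivative _ (spreadSeries a b (line a b g ^ d) (g ^ e * h)) ∧
      PowerSeries.mk l * PowerSeries.map (evalRingHom 0) (spread a b g :
        PowerSeries (MvPolynomial (Fin n) F)[X]) = PowerSeries.derivative _
          (PowerSeries.map (evalRingHom 0) (spread a b g :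
            PowerSeries (MvPolynomial (Fin n) F)[X])) ∧
      ∀ i < d, TendsTo (MvPolynomial.C κ * coord n hp hp0 0
        (AdjoinRoot.of _ (eps F n) * PowerSeries.coeff i L)) (l i) := by
  have hg0 : (line a b g).coeff 0 = MvPolynomial.eval a g := by
    rw [coeff_zero_eq_eval_zero, eval_zero_line, MvPolynomial.aeval_eq_eval]
  have hline0 : line a b h ≠ 0 := by
    intro h1
    rw [h1, isCoprime_zero_right] at hcop
    have h2 := natDegree_eq_zero_of_isUnit (hcop.pow d)
    omega
  generalize hP : line a b g ^ d = p at *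
  set G := line a b g with hG
  set c := MvPolynomial.eval a g with hc
  obtain ⟨u, hudeg, hu⟩ := exists_logDerivative_numerators hd (spread_coeff_coeff a b hgd)
  have hGp : extBase n p (G.map MvPolynomial.C) ^ d = AdjoinRoot.of _ (eps F n) := by
    rw [← extBase_map_p, ← hP, Polynomial.map_pow, map_pow]
  have heps : AdjoinRoot.of (modulus n p) (eps F n) *
      AdjoinRoot.of (modulus n p) (MvPolynomial.C RatFunc.X⁻¹) = 1 := by
    rw [eps, ← map_mul, ← map_mul, mul_inv_cancel₀ RatFunc.X_ne_zero, map_one, map_one]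
  -- the inverse of the constant term of `g`
  obtain ⟨γ, hγc, hγ⟩ : ∃ γ, γ ∈ Set.range (extConst n p) ∧
      extBase n p (G.map MvPolynomial.C) * γ = 1 := by
    -- `G ^ (d - 1) / ε` inverts `G` because `G ^ d = ε`. Unlike `η` below, its regularity at `ε =
    -- 0` is not claimed.
    refine ⟨extBase n p ((G ^ (d - 1)).map MvPolynomial.C) *
      AdjoinRoot.of (modulus n p) (MvPolynomial.C RatFunc.X⁻¹), ?_, ?_⟩
    · rw [← extConst_map, of_C_eq_extConst, ← map_mul]
      exact ⟨_, rfl⟩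
    · rw [← mul_assoc, Polynomial.map_pow, map_pow, ← pow_succ', Nat.sub_add_cancel hd, hGp, heps]
  obtain ⟨η, hηc, hηr, hη⟩ := exists_inverse_of_isCoprime (n := n)
    (show IsCoprime p (line a b h) by rw [← hP]; exact hcop.pow_left) hline0
  obtain ⟨M, hM, hMh⟩ := exists_logDerivative_mem (regularExt n p) (spreadSeries a b p h)
    (fun i => by rw [coeff_spreadSeries]; exact extBase_mem _) hηr
    (by rw [coeff_spreadSeries, spread_coeff_zero, hη])
  have hL := logDerivative_mul hu (extBase n p) (γ := γ) (by rw [spread_coeff_zero, hγ])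
  rw [← spreadSeries_apply] at hL
  -- `L` is `e * g'/g + h'/h`, and `l` is `g'/g` at `Y = 0`, where the constant term is `c = g(a)`.
  -- The scalar `κ` removes `e` and the value `c ^ d` of `G ^ d` at `Y = 0`.
  refine ⟨γ ^ e * η, (PowerSeries.mk fun i => extBase n p (u i) * γ ^ (i + 1)) *
    (e : PowerSeries (Extension n p)) + M, fun i => (u i).eval 0 * MvPolynomial.C c⁻¹ ^ (i + 1),
    RatFunc.C ((e : F)⁻¹ * (c ^ d)⁻¹), ?_, ?_, ?_, logDerivative_mul hu (evalRingHom 0) ?_, ?_⟩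
  · obtain ⟨x, rfl⟩ := hγc
    obtain ⟨y, rfl⟩ := hηc
    rw [← map_pow, ← map_mul]
    exact ⟨_, rfl⟩
  · rw [coeff_spreadSeries, map_mul, mul_coeff_zero, map_pow, coeff_zero_eq_eval_zero,
      eval_pow, ← coeff_zero_eq_eval_zero, spread_coeff_zero, spread_coeff_zero, map_mul, map_pow,
      mul_mul_mul_comm, ← mul_pow, hγ, hη, one_pow, one_mul]
  · rw [map_mul, map_pow, mul_comm (PowerSeries.mk _)]
    exact logDerivative_pow_mul e hL hMh
  · rw [spread_coeff_zero, coe_evalRingHom, ← coeff_zero_eq_eval_zero, coeff_map, hg0, ← map_mul,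
      mul_inv_cancel₀ ha, map_one]
  · intro i hi
    obtain ⟨m, rfl⟩ := Nat.exists_eq_add_of_lt hi
    have hpow : ∀ k, extBase n p (G.map MvPolynomial.C) ^ k * γ ^ k = 1 := fun k => by
      rw [← mul_pow, hγ, one_pow]
    have h1 : AdjoinRoot.of (modulus n p) (eps F n) * (extBase n p (u i) * γ ^ (i + 1)) =
        extBase n p (u i * G.map MvPolynomial.C ^ m) := by
      rw [← hGp, map_mul, map_pow, show i + m + 1 = m + (i + 1) by ring, pow_add]
      linear_combination extBase n p (u i) * extBase n p (G.map MvPolynomial.C) ^ m * hpow (i + 1)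
    have hGdeg : (G.map (MvPolynomial.C : F →+* MvPolynomial (Fin n) F)).natDegree ≤ i + m + 1 := by
      refine natDegree_map_le.trans ?_
      exact (line_natDegree_coeff (S := F) a b g hgd).1
    -- Here `d = i + m + 1`, and `(i + 1) * (d - 1) + m * d = d * d - 1 - i`.
    have h2 : (u i * G.map MvPolynomial.C ^ m).natDegree < p.natDegree := by
      refine (natDegree_mul_le_of_le (hudeg i) (natDegree_pow_le_of_le m hGdeg)).trans_lt ?_
      rw [hpd, Nat.add_sub_cancel]
      nlinarith
    have h3 : (u i * G.map MvPolynomial.C ^ m).coeff 0 = (u i).eval 0 * MvPolynomial.C c ^ m := by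
      rw [coeff_zero_eq_eval_zero, eval_mul, eval_pow, ← coeff_zero_eq_eval_zero (G.map _),
        coeff_map, hg0]
    have hcc : (MvPolynomial.C c : MvPolynomial (Fin n) F) * MvPolynomial.C c⁻¹ = 1 := by
      rw [← map_mul, mul_inv_cancel₀ ha, map_one]
    have h4 : coord n hp hp0 0 (AdjoinRoot.of (modulus n p) (eps F n) *
        PowerSeries.coeff i ((PowerSeries.mk fun i => extBase n p (u i) * γ ^ (i + 1)) *
          (e : PowerSeries (Extension n p)) + M)) =
        fromBase F n (MvPolynomial.C (e : F) * ((u i).eval 0 * MvPolynomial.C c ^ m)) +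
          eps F n * coord n hp hp0 0 (PowerSeries.coeff i M) := by
      have h5 : PowerSeries.coeff i ((PowerSeries.mk fun i => extBase n p (u i) * γ ^ (i + 1)) *
          (e : PowerSeries (Extension n p))) = e • (extBase n p (u i) * γ ^ (i + 1)) := by
        rw [mul_comm, ← nsmul_eq_mul, map_nsmul, PowerSeries.coeff_mk]
      rw [map_add, h5, mul_add, mul_smul_comm, h1, map_add, map_nsmul,
        coord_extBase hp hp0 _ _ h2, h3, ← AdjoinRoot.algebraMap_eq, ← Algebra.smul_def, map_smul,
        smul_eq_mul, map_mul (fromBase F n) (MvPolynomial.C (e : F)), nsmul_eq_mul]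
      simp
    have h6 : TendsTo (coord n hp hp0 0 (AdjoinRoot.of (modulus n p) (eps F n) *
        PowerSeries.coeff i ((PowerSeries.mk fun i => extBase n p (u i) * γ ^ (i + 1)) *
          (e : PowerSeries (Extension n p)) + M)))
        (MvPolynomial.C (e : F) * ((u i).eval 0 * MvPolynomial.C c ^ m)) :=
      ⟨_, coord_mem_regularAtZero hp hp0 0 (hM i), h4⟩
    have h7 : (MvPolynomial.C (RatFunc.C ((e : F)⁻¹ * (c ^ (i + m + 1))⁻¹)) :
        MvPolynomial (Fin n) (RatFunc F)) =
        fromBase F n (MvPolynomial.C ((e : F)⁻¹ * (c ^ (i + m + 1))⁻¹)) := by simp [fromBase]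
    rw [h7]
    convert (tendsTo_fromBase _).mul h6 using 1
    have he' : (MvPolynomial.C (e : F) : MvPolynomial (Fin n) F) * MvPolynomial.C (e : F)⁻¹ =
        1 := by
      rw [← map_mul, mul_inv_cancel₀ (Nat.cast_ne_zero.2 he), map_one]
    have hcm : (MvPolynomial.C c : MvPolynomial (Fin n) F) ^ m * MvPolynomial.C c⁻¹ ^ m = 1 := by
      rw [← mul_pow, hcc, one_pow]
    rw [← inv_pow, map_mul, map_pow, show i + m + 1 = m + (i + 1) by ring, pow_add]
    linear_combination (-(u i).eval 0 * MvPolynomial.C c⁻¹ ^ (i + 1)) * he' -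
      (MvPolynomial.C (e : F) * MvPolynomial.C (e : F)⁻¹ * (u i).eval 0 *
        MvPolynomial.C c⁻¹ ^ (i + 1)) * hcm

end Limit

/-! ### Computing with truncated power series. -/

section PowerSeriesCost

variable {A : Type*} [CommRing A]

/-- Computing the inverse of a power series up to a given order. -/
theorem Cost.powerSeries_inverse {B : Set (PowerSeries A)} {k : ℕ} {f : PowerSeries A} {π : A}
    (h : Cost B k {f}) (hπ : PowerSeries.C π ∈ B) (h0 : (0 : PowerSeries A) ∈ B)
    (h1 : (1 : PowerSeries A) ∈ B) (hm1 : (-1 : PowerSeries A) ∈ B)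
    (hf : PowerSeries.coeff 0 f * π = 1) (D : ℕ) :
    ∃ Q r : PowerSeries A, f * Q = 1 + PowerSeries.X ^ D * r ∧ Cost B (k + 2 * D + 4) {f, Q} := by
  -- Geometric series: `f * π = 1 - N` with `N` divisible by `X`, so `π * ∑ N ^ i` inverts `f` up to
  -- `N ^ D`.
  set N : PowerSeries A := 1 + (-1) * (f * PowerSeries.C π) with hN
  have hXN : PowerSeries.X ∣ N := by
    rw [PowerSeries.X_dvd_iff, hN, map_add, map_mul, map_mul, map_neg, map_one,
      PowerSeries.constantCoeff_C, ← PowerSeries.coeff_zero_eq_constantCoeff_apply, hf]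
    ring
  obtain ⟨r, hr⟩ := pow_dvd_pow_of_dvd hXN D
  refine ⟨PowerSeries.C π * ∑ i ∈ Finset.range D, N ^ i, -r, ?_, ?_⟩
  · have h2 := mul_neg_geom_sum N D
    have h3 : f * PowerSeries.C π = 1 - N := by rw [hN]; ring
    rw [← mul_assoc, h3, h2, hr]; ring
  · have c0 : ∀ {x} (B : Set (PowerSeries A)), x ∈ B → Cost B 0 {x} := fun B hx =>
      .of_subset (Set.singleton_subset_iff.2 hx)
    have hcN : Cost (B ∪ {f}) 3 {N} :=
      (c0 _ (Or.inl h1)).add' ((c0 _ (Or.inl hm1)).mul' (Cost.mul (Or.inr rfl) (Or.inl hπ)))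
    have hcp := Cost.pow_list (B := (B ∪ {f}) ∪ {N}) (a := N) (Or.inr rfl)
      (Or.inl (Or.inl h1)) D
    have hcs : Cost (((B ∪ {f}) ∪ {N}) ∪ ((fun i => N ^ i) '' {j | j < D})) (D * (0 + 1))
        {∑ i ∈ Finset.range D, N ^ i} := by
      have := Cost.sum (B := ((B ∪ {f}) ∪ {N}) ∪ ((fun i => N ^ i) '' {j | j < D})) (k := 0)
        (Finset.range D) (fun i => N ^ i) (Or.inl (Or.inl (Or.inl h0)))
        fun i hi => c0 _ (Or.inr ⟨i, Finset.mem_range.1 hi, rfl⟩)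
      rwa [Finset.card_range] at this
    have hcQ := (c0 (((B ∪ {f}) ∪ {N}) ∪ ((fun i => N ^ i) '' {j | j < D}))
      (Or.inl (Or.inl (Or.inl hπ)))).mul' hcs
    have := h.trans (hcN.trans_right (hcp.trans_right hcQ))
    refine this.mono subset_rfl (by omega) ?_
    rintro x (rfl | rfl)
    · exact Or.inl rfl
    · exact Or.inr rfl

/-- Computing the first coefficients of a power series. -/
theorem Cost.powerSeries_coeff {B : Set (PowerSeries A)} {B' : Set A} {V : Set (PowerSeries A)}
    {k : ℕ} (h : Cost B k V) (h0 : (0 : A) ∈ B') (h1 : (1 : A) ∈ B')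
    (hB : ∀ i, ∀ f ∈ B, PowerSeries.coeff i f ∈ B') (D : ℕ) :
    Cost B' (k * (4 * D ^ 3 + 1)) (⋃ i : Fin D, PowerSeries.coeff (R := A) i '' V) := by
  have := h.coords (B := B') (fun i : Fin D => PowerSeries.coeff (R := A) i)
    (fun i j j' => if (j + j' : ℕ) = i then 1 else 0) (fun i a b => map_add _ _ _)
    (fun i a b => ?_) (fun i j j' => by split_ifs <;> assumption) h0
    (fun i b hb => hB i b hb)
  · rwa [Fintype.card_fin] at this
  · rw [PowerSeries.coeff_mul, Finset.Nat.sum_antidiagonal_eq_sum_range_succ_mk]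
    have h2 : ∀ j : Fin D, (∑ j' : Fin D, (if (j + j' : ℕ) = i then (1 : A) else 0) *
        (PowerSeries.coeff j a * PowerSeries.coeff j' b)) =
        if (j : ℕ) ≤ i then PowerSeries.coeff j a * PowerSeries.coeff (i - j) b else 0 := by
      intro j
      split_ifs with hj
      · rw [Finset.sum_eq_single (⟨i - j, by omega⟩ : Fin D)]
        · simp [hj]
        · intro j' _ hne
          rw [if_neg, zero_mul]
          intro h
          exact hne (Fin.ext (by simp; omega))
        · simp
      · refine Finset.sum_eq_zero fun j' _ => ?_
        rw [if_neg (by omega), zero_mul]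
    simp only [h2]
    rw [Fin.sum_univ_eq_sum_range (fun j => if j ≤ i then
      PowerSeries.coeff j a * PowerSeries.coeff (i - j) b else 0) D, ← Finset.sum_filter]
    refine Finset.sum_congr ?_ fun _ _ => rfl
    ext j
    simp only [Finset.mem_range, Finset.mem_filter]
    omega

/-- Computing the logarithmic derivative of a power series up to a given order. -/
theorem Cost.powerSeries_logDerivative {B : Set (PowerSeries A)} {B' : Set A} {k : ℕ}
    {f L : PowerSeries A} {π ε : A} (h : Cost B k {f})
    (hB : B = {f | ∀ i, PowerSeries.coeff i f ∈ B'})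
    (hnat : ∀ k : ℕ, (k : A) ∈ B') (hm1 : (-1 : A) ∈ B') (hπ : π ∈ B') (hε : ε ∈ B')
    (hf : PowerSeries.coeff 0 f * π = 1) (hL : L * f = PowerSeries.derivative A f) (d : ℕ) :
    Cost B' ((k + 2 * (d + 1) + 4) * (4 * (d + 1) ^ 3 + 1) + d * (4 * d + 1))
      ((fun i => ε * PowerSeries.coeff i L) '' {i | i < d}) := by
  have h0 : (0 : A) ∈ B' := by simpa using hnat 0
  have h1 : (1 : A) ∈ B' := by simpa using hnat 1
  have hC : ∀ c ∈ B', PowerSeries.C c ∈ B := fun c hc => by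
    rw [hB]
    intro i
    rw [PowerSeries.coeff_C]
    split_ifs <;> assumption
  -- Precision `d + 1`, since the derivative shifts indices: coefficients of `L` below `d` involve
  -- those of `f` up to `d`.
  obtain ⟨Q, r, hQ, hcost⟩ := h.powerSeries_inverse (hC _ hπ) (by simpa using hC 0 h0)
    (by simpa using hC 1 h1) (by simpa using hC (-1) hm1) hf (d + 1)
  have hcoef := hcost.powerSeries_coeff h0 h1 (fun i f hf => by rw [hB] at hf; exact hf i) (d + 1)
  refine hcoef.trans_right ?_
  set W := B' ∪ ⋃ i : Fin (d + 1), PowerSeries.coeff (R := A) i '' {f, Q} with hW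
  have hfW : ∀ i ≤ d, PowerSeries.coeff i f ∈ W := fun i hi =>
    Or.inr (Set.mem_iUnion.2 ⟨⟨i, by omega⟩, f, by simp, rfl⟩)
  have hQW : ∀ i ≤ d, PowerSeries.coeff i Q ∈ W := fun i hi =>
    Or.inr (Set.mem_iUnion.2 ⟨⟨i, by omega⟩, Q, by simp, rfl⟩)
  have key : ∀ i < d, PowerSeries.coeff i L = ∑ x ∈ Finset.range (i + 1),
      PowerSeries.coeff (x + 1) f * ((x + 1 : ℕ) : A) * PowerSeries.coeff (i - x) Q := by
    intro i hi
    have e1 : L = PowerSeries.derivative A f * Q - PowerSeries.X ^ (d + 1) * (r * L) := by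
      rw [← hL]; linear_combination (-L) * hQ
    rw [e1, map_sub, PowerSeries.coeff_X_pow_mul', if_neg (by omega), sub_zero,
      PowerSeries.coeff_mul, Finset.Nat.sum_antidiagonal_eq_sum_range_succ_mk]
    refine Finset.sum_congr rfl fun x _ => ?_
    rw [PowerSeries.coeff_derivative]
    push_cast
    rfl
  have hone : ∀ i : Fin d, Cost W (4 * d + 1) {ε * PowerSeries.coeff i L} := by
    intro i
    have hi := i.isLt
    rw [key i hi]
    have hs := Cost.sum (B := W) (k := 2) (Finset.range (i + 1)) (fun x =>
      PowerSeries.coeff (x + 1) f * ((x + 1 : ℕ) : A) * PowerSeries.coeff (i - x) Q) (Or.inl h0)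
      fun x hx => ?_
    · have hε' : Cost W 0 {ε} := .of_subset (Set.singleton_subset_iff.2 (Or.inl hε))
      refine (hε'.mul' hs).mono_cost ?_
      rw [Finset.card_range]
      omega
    · have hx := Finset.mem_range.1 hx
      have hq : Cost W 0 {PowerSeries.coeff (i - x) Q} :=
        .of_subset (Set.singleton_subset_iff.2 (hQW _ (by omega)))
      exact (Cost.mul (hfW (x + 1) (by omega)) (Or.inl (hnat (x + 1)))).mul' hq
  have := Cost.iUnion hone
  rw [Fintype.card_fin] at this
  refine this.mono subset_rfl le_rfl ?_
  rintro _ ⟨i, hi, rfl⟩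
  exact Set.mem_iUnion.2 ⟨⟨i, hi⟩, rfl⟩

end PowerSeriesCost

/-! ### Integrating the logarithmic derivative. -/

section Recovery

variable {F : Type*} [Field F] [CharZero F] {n : ℕ}

/-- Recovering a power series from its logarithmic derivative, up to terms that vanish for
`ε → 0`. -/
theorem exists_cost_of_logDerivative {B : Set (MvPolynomial (Fin n) (RatFunc F))} {d : ℕ}
    {a : ℕ → MvPolynomial (Fin n) (RatFunc F)} {l q : PowerSeries (MvPolynomial (Fin n) F)} {c : F}
    (hB : Set.range MvPolynomial.C ⊆ B) (ha : ∀ i < d, TendsTo (a i) (PowerSeries.coeff i l))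
    (hl : l * q = PowerSeries.derivative _ q) (hc : PowerSeries.coeff 0 q = MvPolynomial.C c) :
    ∃ v, Cost (B ∪ a '' {i | i < d}) ((d + 1) * (2 * d + 2) + (d + 1)) {v} ∧
      TendsTo v (∑ i ∈ Finset.range (d + 1), PowerSeries.coeff i q) := by
  -- The recursion is `i * q_i = ∑ l_x * q_(i-1-x)`, the coefficient form of `l * q = q'`, with each
  -- `l_x` replaced by its approximation `a x`.
  let b : ℕ → MvPolynomial (Fin n) (RatFunc F) := fun i => Nat.strongRec (fun i b =>
    if i = 0 then MvPolynomial.C (RatFunc.C c) else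
      MvPolynomial.C (RatFunc.C (i : F)⁻¹) * ∑ x : Fin i, a x * b (i - 1 - x) (by omega)) i
  have hb : ∀ i, b i = if i = 0 then MvPolynomial.C (RatFunc.C c) else
      MvPolynomial.C (RatFunc.C (i : F)⁻¹) * ∑ x ∈ Finset.range i, a x * b (i - 1 - x) := by
    intro i
    rw [← Fin.sum_univ_eq_sum_range (fun x => a x * b (i - 1 - x))]
    simp only [b]
    rw [Nat.strongRec]
  have hC : ∀ c : F, (MvPolynomial.C (RatFunc.C c) : MvPolynomial (Fin n) (RatFunc F)) =
      fromBase F n (MvPolynomial.C c) := fun c => by simp [fromBase]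
  have hCB : ∀ c : RatFunc F, MvPolynomial.C c ∈ B := fun c => hB ⟨c, rfl⟩
  have h0 : (0 : MvPolynomial (Fin n) (RatFunc F)) ∈ B := by simpa using hCB 0
  have hlim : ∀ i ≤ d, TendsTo (b i) (PowerSeries.coeff i q) := by
    intro i
    induction i using Nat.strong_induction_on with
    | _ i ih =>
      intro hi
      rw [hb]
      split_ifs with hi0
      · rw [hi0, hc, hC]
        exact tendsTo_fromBase _
      · obtain ⟨j, rfl⟩ := Nat.exists_eq_succ_of_ne_zero hi0
        have h1 : TendsTo (MvPolynomial.C (RatFunc.C ((j + 1 : ℕ) : F)⁻¹) *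
            ∑ x ∈ Finset.range (j + 1), a x * b (j + 1 - 1 - x))
            (MvPolynomial.C ((j + 1 : ℕ) : F)⁻¹ * ∑ x ∈ Finset.range (j + 1),
              PowerSeries.coeff x l * PowerSeries.coeff (j + 1 - 1 - x) q) := by
          rw [hC]
          refine (tendsTo_fromBase _).mul (TendsTo.sum _ fun x hx => ?_)
          have hx := Finset.mem_range.1 hx
          exact (ha x (by omega)).mul (ih _ (by omega) (by omega))
        convert h1 using 1
        have h2 := congrArg (PowerSeries.coeff j) hl
        rw [PowerSeries.coeff_mul, Finset.Nat.sum_antidiagonal_eq_sum_range_succ_mk,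
          PowerSeries.coeff_derivative] at h2
        simp only [Nat.add_sub_cancel]
        rw [Nat.succ_eq_add_one] at *
        rw [h2]
        have h3 : (MvPolynomial.C ((j + 1 : ℕ) : F)⁻¹ : MvPolynomial (Fin n) F) *
            ((j : MvPolynomial (Fin n) F) + 1) = 1 := by
          have : ((j : MvPolynomial (Fin n) F) + 1) = MvPolynomial.C ((j + 1 : ℕ) : F) := by simp
          rw [this, ← map_mul, inv_mul_cancel₀ (by exact_mod_cast Nat.succ_ne_zero j), map_one]
        linear_combination (-PowerSeries.coeff (j + 1) q) * h3
  refine ⟨∑ i ∈ Finset.range (d + 1), b i, ?_, TendsTo.sum _ fun i hi =>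
    hlim i (by have := Finset.mem_range.1 hi; omega)⟩
  have hseq := Cost.seq (B := B ∪ a '' {i | i < d}) (k := 2 * d + 2) b (d + 1) (fun i hi => ?_)
  · refine hseq.trans_right ?_
    have := Cost.sum (B := (B ∪ a '' {i | i < d}) ∪ b '' {j | j < d + 1}) (k := 0)
      (Finset.range (d + 1)) b (Or.inl (Or.inl h0))
      fun i hi => .of_subset (Set.singleton_subset_iff.2 (Or.inr ⟨i, Finset.mem_range.1 hi, rfl⟩))
    rw [Finset.card_range] at this
    exact this.mono_cost (by omega)
  · rw [hb]
    split_ifs with hi0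
    · exact .of_subset (Set.singleton_subset_iff.2 (Or.inl (Or.inl (hCB _))))
    · have hs := Cost.sum (B := (B ∪ a '' {i | i < d}) ∪ b '' {j | j < i}) (k := 1)
        (Finset.range i) (fun x => a x * b (i - 1 - x)) (Or.inl (Or.inl h0)) fun x hx => by
          have hx := Finset.mem_range.1 hx
          exact Cost.mul (Or.inl (Or.inr ⟨x, by simp; omega, rfl⟩))
            (Or.inr ⟨i - 1 - x, by simp; omega, rfl⟩)
      have hcc : Cost ((B ∪ a '' {i | i < d}) ∪ b '' {j | j < i}) 0
          {MvPolynomial.C (RatFunc.C (i : F)⁻¹)} :=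
        .of_subset (Set.singleton_subset_iff.2 (Or.inl (Or.inl (hCB _))))
      refine (hcc.mul' hs).mono_cost ?_
      rw [Finset.card_range]
      omega

end Recovery

/-! ### Assembly: prime factors, arbitrary factors, and the final bound. -/

section Factor

open Polynomial

/-- A bound for the number of steps that border compute a factor of degree `d` of a polynomial
computed in `k` steps. -/
def factorBound (k d : ℕ) : ℕ :=
  ((((k + 2 * (d + 1) + 4) * (4 * (d + 1) ^ 3 + 1) + d * (4 * d + 1)) *
    (4 * (d * d) ^ 3 + 1) + d * 1) + ((d + 1) * (2 * d + 2) + (d + 1))) * (2 * 1 + 1) + 1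

theorem factorBound_mono {k k' d d' : ℕ} (hk : k ≤ k') (hd : d ≤ d') :
    factorBound k d ≤ factorBound k' d' := by
  unfold factorBound
  gcongr

variable {F : Type*} [Field F] {n : ℕ}

/-- The only nonscalar inputs of the simulation are the `x_j - a_j`; each is later paid for with one
addition. -/
theorem coeff_spreadSeries_leaves_mem (a b : Fin n → F) (p : F[X])
    {f : MvPolynomial (Fin n) F} (hf : f ∈ leaves F n) (i : ℕ) :
    PowerSeries.coeff i (spreadSeries a b p f) ∈ Set.range (extConst n p) ∪
      Set.range fun j => extBase n p (C (MvPolynomial.X j - MvPolynomial.C (a j))) := by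
  have h0 : (0 : Extension n p) ∈ Set.range (extConst n p) := ⟨0, map_zero _⟩
  rw [coeff_spreadSeries]
  rcases hf with ⟨c, rfl⟩ | ⟨j, rfl⟩
  · left
    rw [spread_C, coeff_C]
    split_ifs
    · exact ⟨(C c).map RatFunc.C, by rw [extConst_map, map_C]⟩
    · rwa [map_zero]
  · rw [spread_X]
    rcases i with _ | _ | i
    · left
      refine ⟨(C (a j) + C (b j) * X).map RatFunc.C, ?_⟩
      rw [extConst_map]
      simp
    · right
      exact ⟨j, by simp [coeff_C]⟩
    · left
      simpa [coeff_X_mul, coeff_C] using h0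

theorem borderCost_of_isCoprime_line [CharZero F] (a b : Fin n → F) {g h : MvPolynomial (Fin n) F}
    {k e : ℕ} (hP : Cost (leaves F n) k {g ^ e * h}) (hd : 1 ≤ g.totalDegree) (he : e ≠ 0)
    (hb : MvPolynomial.eval b (MvPolynomial.homogeneousComponent g.totalDegree g) = 1)
    (ha : MvPolynomial.eval a g ≠ 0) (hcop : IsCoprime (line a b g) (line a b h)) :
    BorderCost (factorBound k g.totalDegree) g := by
  set d := g.totalDegree with hdd
  have hline := line_natDegree_coeff (S := F) a b g (D := d) le_rfl
  rw [hb, map_one] at hline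
  have hmonic : (line a b g).Monic := monic_of_natDegree_le_of_coeff_eq_one _ hline.1 hline.2
  have hdeg : (line a b g).natDegree = d :=
    natDegree_eq_of_le_of_coeff_ne_zero hline.1 (by rw [hline.2]; exact one_ne_zero)
  -- The exponent `d` is what lets `ε` absorb the denominators `G ^ (i + 1)` for all `i < d`.
  have hp : (line a b g ^ d).Monic := hmonic.pow d
  have hpd : (line a b g ^ d).natDegree = d * d := by rw [hmonic.natDegree_pow, hdeg]
  have hp0 : 0 < (line a b g ^ d).natDegree := by rw [hpd]; positivity
  obtain ⟨π, L, l, κ, hπ, hπ1, hL, hl, hlim⟩ :=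
    exists_logDerivative_limit a b hd le_rfl he ha hcop hp hp0 hpd
  set BE : Set (Extension n (line a b g ^ d)) := Set.range (extConst n (line a b g ^ d)) ∪
    Set.range fun j => extBase n (line a b g ^ d)
      (C (MvPolynomial.X j - MvPolynomial.C (a j))) with hBE
  set BR : Set (MvPolynomial (Fin n) (RatFunc F)) := Set.range MvPolynomial.C ∪
    Set.range fun j => fromBase F n (MvPolynomial.X j - MvPolynomial.C (a j)) with hBR
  have c1 : Cost
      {f : PowerSeries (Extension n (line a b g ^ d)) | ∀ i, PowerSeries.coeff i f ∈ BE} k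
      {spreadSeries a b (line a b g ^ d) (g ^ e * h)} := by
    have := hP.map (spreadSeries a b (line a b g ^ d))
    rw [Set.image_singleton] at this
    refine this.mono ?_ le_rfl subset_rfl
    rintro _ ⟨f, hf, rfl⟩ i
    exact coeff_spreadSeries_leaves_mem a b (line a b g ^ d) hf i
  have c2 := c1.powerSeries_logDerivative (B' := BE) (π := π)
    (ε := AdjoinRoot.of (modulus n (line a b g ^ d)) (eps F n)) rfl
    (fun k => Or.inl ⟨k, map_natCast _ _⟩)
    (Or.inl ⟨-1, by rw [map_neg, map_one]⟩) (Or.inl hπ)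
    (Or.inl ⟨_, (of_C_eq_extConst (line a b g ^ d) _).symm⟩) hπ1 hL d
  have c3 := c2.of_extension hp hp0 (B := BR) Set.subset_union_left (by
    rintro i x (⟨y, rfl⟩ | ⟨j, rfl⟩)
    · exact Or.inl (coord_extConst_mem hp hp0 i y)
    · rw [coord_extBase hp hp0 _ _ (by rw [natDegree_C]; exact hp0), coeff_C]
      split_ifs
      · exact Or.inr ⟨j, rfl⟩
      · exact Or.inl ⟨0, by rw [map_zero, map_zero]⟩)
  rw [hpd, Set.image_image] at c3
  have c4 := c3.trans_right (Cost.iUnion (V := fun i : Fin d => {MvPolynomial.C κ *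
    coord n hp hp0 0 (AdjoinRoot.of (modulus n (line a b g ^ d)) (eps F n) *
      PowerSeries.coeff i L)})
    fun i => Cost.mul (Or.inl (Or.inl ⟨κ, rfl⟩)) (Or.inr ⟨i, i.isLt, rfl⟩))
  rw [Fintype.card_fin] at c4
  obtain ⟨v, hv, hvlim⟩ := exists_cost_of_logDerivative (B := BR) (d := d)
    (c := MvPolynomial.eval a g) Set.subset_union_left
    (fun i hi => by rw [PowerSeries.coeff_mk]; exact hlim i hi) hl (by
      rw [PowerSeries.coeff_map, Polynomial.coeff_coe, spread_coeff_zero, coe_evalRingHom,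
        ← coeff_zero_eq_eval_zero, coeff_map, coeff_zero_eq_eval_zero, eval_zero_line,
        MvPolynomial.aeval_eq_eval])
  have c5 := c4.trans_right (hv.mono (Set.union_subset_union_right _ (by
    rintro _ ⟨i, hi, rfl⟩
    exact Set.mem_iUnion.2 ⟨⟨i, hi⟩, rfl⟩)) le_rfl subset_rfl)
  refine ⟨v, c5.subst (B' := leaves (RatFunc F) n) (l := 1) ?_, ?_⟩
  · rintro x (hx | ⟨j, rfl⟩)
    · exact .of_subset (Set.singleton_subset_iff.2 (Or.inl hx))
    · have : fromBase F n (MvPolynomial.X j - MvPolynomial.C (a j)) =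
          MvPolynomial.X j + MvPolynomial.C (RatFunc.C (-a j)) := by
        simp [fromBase, sub_eq_add_neg]
      simp only [this]
      exact Cost.add (Or.inr ⟨j, rfl⟩) (Or.inl ⟨_, rfl⟩)
  · convert hvlim using 1
    rw [← spread_sum_coeff_coeff_zero a b (f := g) (D := d) le_rfl]
    refine Finset.sum_congr rfl fun i _ => ?_
    rw [spread_sum_coeff_coeff_zero a b (f := g) (D := d) le_rfl, PowerSeries.coeff_map,
      Polynomial.coeff_coe, coe_evalRingHom, coeff_zero_eq_eval_zero]

theorem MvPolynomial.homogeneousComponent_totalDegree_ne_zero {f : MvPolynomial (Fin n) F}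
    (hf : f ≠ 0) : MvPolynomial.homogeneousComponent f.totalDegree f ≠ 0 := by
  obtain ⟨m, hm, hmd⟩ := Finset.exists_mem_eq_sup f.support
    (MvPolynomial.support_nonempty.2 hf) fun m => m.sum fun _ e => e
  intro h
  have h1 := congrArg (MvPolynomial.coeff m) h
  rw [MvPolynomial.coeff_homogeneousComponent,
    if_pos (show m.degree = f.totalDegree from hmd.symm), MvPolynomial.coeff_zero] at h1
  exact MvPolynomial.mem_support_iff.1 hm h1

theorem borderCost_of_prime [CharZero F] {P g : MvPolynomial (Fin n) F} {k : ℕ}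
    (hP : Cost (leaves F n) k {P}) (hP0 : P ≠ 0) (hg : Prime g) (hgP : g ∣ P) :
    1 ≤ g.totalDegree ∧ BorderCost (factorBound k g.totalDegree + 1) g := by
  have hd : 1 ≤ g.totalDegree := by
    by_contra! h
    obtain ⟨c, hc⟩ : ∃ c, g = MvPolynomial.C c :=
      ⟨_, MvPolynomial.totalDegree_eq_zero_iff_eq_C.1 (by omega)⟩
    have hc0 : c ≠ 0 := by rintro rfl; exact hg.ne_zero (by simp [hc])
    exact hg.not_isUnit (hc ▸ (isUnit_iff_ne_zero.2 hc0).map MvPolynomial.C)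
  refine ⟨hd, ?_⟩
  obtain ⟨b, hb⟩ := MvPolynomial.exists_eval_ne_zero
    (MvPolynomial.homogeneousComponent_totalDegree_ne_zero hg.ne_zero)
  set c := MvPolynomial.eval b (MvPolynomial.homogeneousComponent g.totalDegree g) with hc
  have hcc : (MvPolynomial.C c : MvPolynomial (Fin n) F) * MvPolynomial.C c⁻¹ = 1 := by
    rw [← map_mul, mul_inv_cancel₀ hb, map_one]
  have hunit : IsUnit (MvPolynomial.C c⁻¹ : MvPolynomial (Fin n) F) :=
    .of_mul_eq_one _ ((mul_comm _ _).trans hcc)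
  -- Scaling makes the restriction to lines of direction `b` monic; the factor `c` is restored at
  -- the end by one multiplication.
  set g' := MvPolynomial.C c⁻¹ * g with hg'
  have hassoc : Associated g' g := (associated_isUnit_mul_left_iff hunit).2 (Associated.refl g)
  have hg'p : Prime g' := hassoc.symm.prime hg
  have hdeg : g'.totalDegree = g.totalDegree := by
    rw [hg', MvPolynomial.totalDegree_mul_of_isDomain (by simpa using hb) hg.ne_zero,
      MvPolynomial.totalDegree_C, zero_add]
  have hb' : MvPolynomial.eval b (MvPolynomial.homogeneousComponent g'.totalDegree g') = 1 := by
    rw [hdeg, hg', MvPolynomial.homogeneousComponent_C_mul, map_mul, MvPolynomial.eval_C, ← hc,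
      inv_mul_cancel₀ hb]
  have hfin : FiniteMultiplicity g' P := .of_prime_left hg'p hP0
  obtain ⟨h, hPh, hgh⟩ := hfin.exists_eq_pow_mul_and_not_dvd
  have he : multiplicity g' P ≠ 0 := by
    rw [Ne, multiplicity_eq_zero, not_not]
    exact hassoc.dvd.trans hgP
  obtain ⟨a, ha, hcop⟩ := exists_isCoprime_line b hg'p hb' hgh
  rw [hPh] at hP
  have hmain := borderCost_of_isCoprime_line a b hP (by rw [hdeg]; exact hd) he hb' ha hcop
  have hgg : g = MvPolynomial.C c * g' := by
    rw [hg', ← mul_assoc, hcc, one_mul]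
  have hfin := (borderCost_C c).mul hmain
  rw [← hgg, hdeg] at hfin
  exact hfin.mono (by omega)

/-- A product of prime factors is border computed factor by factor. -/
theorem borderCost_of_dvd [CharZero F] {P : MvPolynomial (Fin n) F} {k D : ℕ}
    (hP : Cost (leaves F n) k {P}) (hP0 : P ≠ 0) (g : MvPolynomial (Fin n) F) :
    g ∣ P → g.totalDegree ≤ D → BorderCost (g.totalDegree * (factorBound k D + 2)) g := by
  induction g using UniqueFactorizationMonoid.induction_on_prime with
  | h₁ => exact fun h => absurd (zero_dvd_iff.1 h) hP0
  | h₂ x hx =>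
    intro _ _
    obtain ⟨c, hc, rfl⟩ := MvPolynomial.isUnit_iff_eq_C_of_isReduced.1 hx
    exact (borderCost_C c).mono (Nat.zero_le _)
  | h₃ a p ha hp ih =>
    intro hdvd hD
    -- Degrees add up and each prime has degree at least one, so the degree pays for all prime
    -- factors and the products joining them.
    rw [MvPolynomial.totalDegree_mul_of_isDomain hp.ne_zero ha] at hD ⊢
    obtain ⟨h1, h2⟩ := borderCost_of_prime hP hP0 hp ((dvd_mul_right p a).trans hdvd)
    have h3 := ih ((dvd_mul_left a p).trans hdvd) (by omega)
    refine (h2.mul h3).mono ?_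
    have h4 : factorBound k p.totalDegree ≤ factorBound k D := factorBound_mono le_rfl (by omega)
    nlinarith

end Factor

theorem mainTheorem9 :
    ∃ q : Polynomial ℕ,
      ∀ (F : Type*) [Field F] [CharZero F] (n s : ℕ) (P g : MvPolynomial (Fin n) F),
        P ≠ 0 →
        (∃ C : Circuit F n, C.Computes P ∧ C.size = s) →
        g ∣ P →
        borderSize g ≤ ((q.eval (s + g.totalDegree) : ℕ) : ℕ∞) := by
  let Y : Polynomial ℕ := Polynomial.X
  let K1 : Polynomial ℕ := (2 * Y + 2 * (Y + 1) + 4) * (4 * (Y + 1) ^ 3 + 1) + Y * (4 * Y + 1)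
  let K2 : Polynomial ℕ := (K1 * (4 * (Y * Y) ^ 3 + 1) + Y * 1) + ((Y + 1) * (2 * Y + 2) + (Y + 1))
  -- This is `factorBound` at `k = 2 * Y`, `d = Y`, inserted in the bounds for factors and for
  -- border size. The `2` in `k` counts a scaling and an operation per wire.
  refine ⟨2 * (Y * (K2 * (2 * 1 + 1) + 1 + 2) + 1), ?_⟩
  rintro F _ _ n s P g hP ⟨C, hC, rfl⟩ hg
  have hcost : Cost (leaves F n) (2 * C.size) {P} := by
    rw [← show C.value C.output = P from hC]
    exact C.cost C.output
  refine (borderCost_of_dvd hcost hP g hg le_rfl).borderSize_le.trans ?_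
  rw [Nat.cast_le]
  have h1 : factorBound (2 * C.size) g.totalDegree ≤
      factorBound (2 * (C.size + g.totalDegree)) (C.size + g.totalDegree) :=
    factorBound_mono (by omega) (by omega)
  have h2 : g.totalDegree ≤ C.size + g.totalDegree := by omega
  refine (show _ ≤ 2 * ((C.size + g.totalDegree) * (factorBound (2 * (C.size + g.totalDegree))
    (C.size + g.totalDegree) + 2) + 1) by gcongr).trans (le_of_eq ?_)
  simp [Y, K1, K2, factorBound]
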